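/- Let $\mathcal H\neq\{0\}$ be a quaternionic Hilbert space, i.e. a right $\mathbb H$-module with an $\mathbb H$-valued scalar product that is right linear in the second argument, conjugate symmetric and positive definite, and that is complete in the induced norm. Let $\mathcal B(\mathcal H)$ be the real unital $*$-algebra of bounded right linear operators on $\mathcal H$, and let $\mathbb S=\{i\in\mathbb H: i^2=-1\}$. A von Neumann algebra on $\mathcal H$ is a unital real $*$-subalgebra $\mathfrak R\subseteq\mathcal B(\mathcal H)$ with $\mathfrak R''=\mathfrak R$, where $\mathfrak M'$ denotes the commutant of $\mathfrak M$ in $\mathcal B(\mathcal H)$; it is irreducible if $\{0\}$ and $\mathcal H$ are the only closed ($\mathbb H$-linear) subspaces invariant under all its elements. Write $Z(\mathfrak R)=\mathfrak R\cap\mathfrak R'$ for its centre and $\mathcal L(\mathfrak R)$ for the set of orthogonal projections in $\mathfrak R$, ordered by inclusion of ranges, with orthocomplement $E\mapsto\mathcal I-E$. For a real, complex or quaternionic Hilbert space $V$ put $\mathcal L(V)=\mathcal L(\mathcal B(V))$. Let $\mathfrak R$ be an irreducible von Neumann algebra on $\mathcal H$. Then, as a real algebra, the commutant $\mathfrak R'$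 is isomorphic to exactly one of $\mathbb R$, $\mathbb C$, $\mathbb H$, and the following hold. (i) (Proper quaternionic.) If $\mathfrak R'\cong\mathbb R$, then $\mathfrak R'=\{a\mathcal I:a\in\mathbb R\}$, $\mathfrak R=\mathcal B(\mathcal H)$, $Z(\mathfrak R)=\{a\mathcal I:a\in\mathbb R\}$ and $\mathcal L(\mathfrak R)=\mathcal L(\mathcal H)$. (ii) (Complex-induced.) If $\mathfrak R'\cong\mathbb C$, then there is a unitary anti-selfadjoint operator $J$ on $\mathcal H$, unique up to sign, with $\mathfrak R'=\{a\mathcal I+bJ:a,b\in\mathbb R\}$. Moreover $Z(\mathfrak R)=\{a\mathcal I+bJ:a,b\in\mathbb R\}$. For every $i\in\mathbb S$, the set $\mathcal H^+_{J,i}=\{v\in\mathcal H:Jv=vi\}$ is, with the structure inherited from $\mathcal H$, a complex Hilbert space over $\mathbb C_i=\{x+iy:x,y\in\mathbb R\}\cong\mathbb C$, and $\mathfrak R$ is identified with $\mathcal B(\mathcal H^+_{J,i})$ in the sense (*) below, with $V=\mathcal H^+_{J,i}$. (iii) (Real-induced.) If $\mathfrak R'\cong\mathbb H$, then there are mutually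 anticommuting unitary anti-selfadjoint operators $I,J,K$ on $\mathcal H$, none of which belongs to $\mathfrak R$, with $IJ=K$ and $\mathfrak R'=\{a\mathcal I+bI+cJ+dK:a,b,c,d\in\mathbb R\}$. Moreover $Z(\mathfrak R)=\{a\mathcal I:a\in\mathbb R\}$. For all $i,j\in\mathbb S$ with $i\perp j$, the set $\mathcal H_{\mathbb R}=\{v\in\mathcal H:Iv=vi,\ Jv=vj\}$ is, with the structure inherited from $\mathcal H$, a real Hilbert space, and $\mathfrak R$ is identified with $\mathcal B(\mathcal H_{\mathbb R})$ in the sense (*) below, with $V=\mathcal H_{\mathbb R}$. (*) Every bounded linear operator on $V$ has exactly one extension to an operator in $\mathcal B(\mathcal H)$; the operators in $\mathfrak R$ are exactly these extensions; restriction to $V$ is an isomorphism of real $*$-algebras $\mathfrak R\cong\mathcal B(V)$; and restriction to $V$ is an isomorphism $\mathcal L(\mathfrak R)\cong\mathcal L(V)$ of lattices with orthocomplementation. -/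

import Mathlib

open scoped Quaternion RightActions

/-- A quaternionic (right) Hilbert space: a right `ℍ`-module with an `ℍ`-valued scalar product that
is right linear in its second argument, conjugate symmetric and induces the (complete) norm.
The right action of `a` on `v` is written `v <• a`. -/
class QuaternionicHilbertSpace (H : Type*) [NormedAddCommGroup H] extends
    Module (ℍ[ℝ])ᵐᵒᵖ H, CompleteSpace H where
  qinner : H → H → ℍ[ℝ]
  qinner_add_right : ∀ u v w, qinner u (v + w) = qinner u v + qinner u w
  qinner_smul_right : ∀ u v (a : ℍ[ℝ]), qinner u (v <• a) = qinner u v * a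
  star_qinner : ∀ u v, star (qinner u v) = qinner v u
  qinner_self : ∀ v, qinner v v = ((‖v‖ ^ 2 : ℝ) : ℍ[ℝ])

namespace QuatHilbert

open QuaternionicHilbertSpace

variable {H : Type*} [NormedAddCommGroup H] [QuaternionicHilbertSpace H]

theorem qinner_add_left (u v w : H) : qinner (u + v) w = qinner u w + qinner v w := by
  rw [← star_qinner w, qinner_add_right, star_add, star_qinner, star_qinner]

theorem qinner_smul_left (u v : H) (a : ℍ[ℝ]) : qinner (u <• a) v = star a * qinner u v := by
  rw [← star_qinner v, qinner_smul_right, star_mul, star_qinner]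

theorem norm_smul_right (v : H) (a : ℍ[ℝ]) : ‖v <• a‖ = ‖v‖ * ‖a‖ := by
  have h := qinner_self (v <• a)
  rw [qinner_smul_right, qinner_smul_left, qinner_self, mul_assoc,
    Quaternion.coe_commutes (‖v‖ ^ 2) a, ← mul_assoc,
    Quaternion.star_mul_self, ← Quaternion.coe_mul] at h
  have h2 := Quaternion.coe_injective h
  rw [Quaternion.normSq_eq_norm_mul_self] at h2
  have h3 : ‖v <• a‖ ^ 2 = (‖v‖ * ‖a‖) ^ 2 := by rw [← h2]; ring
  exact (sq_eq_sq₀ (norm_nonneg _) (by positivity)).1 h3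

/-- The underlying real vector space: real scalars act as real quaternions. -/
noncomputable instance instModuleReal : Module ℝ H := Module.compHom H (algebraMap ℝ (ℍ[ℝ])ᵐᵒᵖ)

theorem real_smul_def (r : ℝ) (v : H) : r • v = v <• (r : ℍ[ℝ]) := rfl

/-- The underlying real Hilbert space, with scalar product `Re ⟨u, v⟩`. -/
noncomputable instance instInnerProductSpaceReal : InnerProductSpace ℝ H where
  norm_smul_le r v := by
    rw [real_smul_def, norm_smul_right, mul_comm, Quaternion.norm_coe]
  inner u v := (qinner u v).re
  norm_sq_eq_re_inner v := by
    rw [qinner_self, Quaternion.re_coe]; rfl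
  conj_inner_symm u v := by rw [← star_qinner]; simp
  add_left u v w := by simp [qinner_add_left]
  smul_left u v r := by
    rw [real_smul_def, qinner_smul_left]; simp

theorem real_inner_def (u v : H) : inner ℝ u v = (qinner u v).re := rfl

instance instIsScalarTower : IsScalarTower ℝ (ℍ[ℝ])ᵐᵒᵖ H where
  smul_assoc r a v := by
    have h : r • a = algebraMap ℝ (ℍ[ℝ])ᵐᵒᵖ r * a := Algebra.smul_def r a
    rw [h, mul_smul]; rfl

instance instContinuousConstSMul : ContinuousConstSMul (ℍ[ℝ])ᵐᵒᵖ H where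
  continuous_const_smul a := by
    have : (fun v : H => a • v) = (DistribSMul.toAddMonoidHom H a) := rfl
    rw [this]
    exact AddMonoidHomClass.continuous_of_bound _ ‖a.unop‖
      (fun v => by
        have := norm_smul_right v a.unop
        simpa [mul_comm] using this.le)

end QuatHilbert

/-- `𝓑 H`: the bounded right linear operators on the quaternionic Hilbert space `H`. -/
abbrev QuatHilbert.BoundedOp (H : Type*) [NormedAddCommGroup H] [QuaternionicHilbertSpace H] :=
  H →L[(ℍ[ℝ])ᵐᵒᵖ] H

namespace QuatHilbert

open QuaternionicHilbertSpace

variable {H : Type*} [NormedAddCommGroup H] [QuaternionicHilbertSpace H]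

noncomputable instance instAlgebraBoundedOp : Algebra ℝ (BoundedOp H) :=
  Algebra.ofModule (fun _ _ _ => rfl)
    (fun r S T => by ext v; exact (S.restrictScalars ℝ).map_smul r (T v))

theorem real_inner_smul_right_action (u v : H) (a : ℍ[ℝ]) :
    inner ℝ (u <• a) v = inner ℝ u (v <• star a) := by
  simp only [real_inner_def, qinner_smul_left, qinner_smul_right, Quaternion.re_mul]
  simp only [Quaternion.re_star, Quaternion.imI_star, Quaternion.imJ_star, Quaternion.imK_star]
  ring

/-- The adjoint of a bounded right linear operator: the adjoint on the underlying real Hilbert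
space, which is right linear. It is characterised by `qinner_star_apply`. -/
noncomputable instance instStarBoundedOp : Star (BoundedOp H) where
  star T :=
    { toFun := ContinuousLinearMap.adjoint (T.restrictScalars ℝ)
      map_add' := map_add _
      map_smul' := fun a v => by
        refine ext_inner_left ℝ fun w => ?_
        obtain ⟨b, rfl⟩ : ∃ b : ℍ[ℝ], a = MulOpposite.op (star b) :=
          ⟨star a.unop, by simp⟩
        rw [RingHom.id_apply, ContinuousLinearMap.adjoint_inner_right,
          ← real_inner_smul_right_action, ← real_inner_smul_right_action,
          ContinuousLinearMap.adjoint_inner_right]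
        congr 1
        exact (T.map_smul (MulOpposite.op b) w).symm
      cont := (ContinuousLinearMap.adjoint (T.restrictScalars ℝ)).continuous }

theorem restrictScalars_star (T : BoundedOp H) :
    (star T).restrictScalars ℝ = ContinuousLinearMap.adjoint (T.restrictScalars ℝ) := rfl

/-- `star T` is the adjoint of `T` with respect to the quaternionic scalar product. -/
theorem qinner_star_apply (T : BoundedOp H) (u v : H) :
    qinner (star T u) v = qinner u (T v) := by
  have key : ∀ w : H, (qinner (star T u) w).re = (qinner u (T w)).re := fun w =>
    ContinuousLinearMap.adjoint_inner_left (T.restrictScalars ℝ) w u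
  have key2 : ∀ a : ℍ[ℝ], (qinner (star T u) v * a).re = (qinner u (T v) * a).re := fun a => by
    have h := key (v <• a)
    rw [qinner_smul_right] at h
    rw [h, T.map_smul, qinner_smul_right]
  have h0 := key2 1
  have h1 := key2 ⟨0, 1, 0, 0⟩
  have h2 := key2 ⟨0, 0, 1, 0⟩
  have h3 := key2 ⟨0, 0, 0, 1⟩
  have e : ∀ q a : ℍ[ℝ], (q * a).re =
      q.re * a.re - q.imI * a.imI - q.imJ * a.imJ - q.imK * a.imK := fun q a => by
    simp
  replace h1 := (e _ _).symm.trans (h1.trans (e _ _))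
  replace h2 := (e _ _).symm.trans (h2.trans (e _ _))
  replace h3 := (e _ _).symm.trans (h3.trans (e _ _))
  rw [mul_one, mul_one] at h0
  apply Quaternion.ext <;> linarith

theorem restrictScalars_real_injective {S T : BoundedOp H}
    (h : S.restrictScalars ℝ = T.restrictScalars ℝ) : S = T := by
  ext v
  exact congrArg (fun A : H →L[ℝ] H => A v) h

noncomputable instance instStarRingBoundedOp : StarRing (BoundedOp H) where
  star_involutive T := by
    apply restrictScalars_real_injective
    rw [restrictScalars_star, restrictScalars_star, ContinuousLinearMap.adjoint_adjoint]
  star_mul S T := by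
    apply restrictScalars_real_injective
    exact ContinuousLinearMap.adjoint_comp (S.restrictScalars ℝ) (T.restrictScalars ℝ)
  star_add S T := by
    apply restrictScalars_real_injective
    exact map_add ContinuousLinearMap.adjoint (S.restrictScalars ℝ) (T.restrictScalars ℝ)

instance instStarModuleBoundedOp : StarModule ℝ (BoundedOp H) where
  star_smul r T := by
    apply restrictScalars_real_injective
    exact (ContinuousLinearMap.adjoint (𝕜 := ℝ) (E := H) (F := H)).map_smulₛₗ r
      (T.restrictScalars ℝ)

/-! ### Von Neumann algebras, irreducibility, projections -/

/-- A unital `*`-subalgebra of `𝓑 H` is a von Neumann algebra if it equals its bicommutant. -/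
def IsVonNeumannAlgebra (R : StarSubalgebra ℝ (BoundedOp H)) : Prop :=
  Set.centralizer (Set.centralizer (R : Set (BoundedOp H))) = R

/-- No closed quaternionic subspace other than `0` and `H` is invariant under the family. -/
def IsIrreducibleFamily (R : Set (BoundedOp H)) : Prop :=
  ∀ K : Submodule (ℍ[ℝ])ᵐᵒᵖ H, IsClosed (K : Set H) →
    (∀ A ∈ R, ∀ v ∈ K, A v ∈ K) → K = ⊥ ∨ K = ⊤

/-- The commutant, as a real algebra. -/
noncomputable def commutant (R : StarSubalgebra ℝ (BoundedOp H)) : Subalgebra ℝ (BoundedOp H) :=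
  Subalgebra.centralizer ℝ (R : Set (BoundedOp H))

/-- The centre `R ∩ R'`. -/
def center (R : StarSubalgebra ℝ (BoundedOp H)) : Set (BoundedOp H) :=
  (R : Set (BoundedOp H)) ∩ commutant R

/-- Unitary and anti-selfadjoint operators. -/
def IsUnitaryAntiSelfAdjoint (J : BoundedOp H) : Prop :=
  J ∈ unitary (BoundedOp H) ∧ star J = -J

/-- The set `𝓛(R)` of orthogonal projections in a set `R` of bounded operators; it is used for real,
complex and quaternionic Hilbert spaces alike. -/
@[ext]
structure Projections {k M : Type*} [Semiring k] [AddCommGroup M] [TopologicalSpace M]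
    [IsTopologicalAddGroup M] [Module k M] [StarRing (M →L[k] M)] (R : Set (M →L[k] M)) where
  op : M →L[k] M
  mem : op ∈ R
  isStarProjection : IsStarProjection op

/-- Projections are ordered by inclusion of their ranges. -/
instance {k M : Type*} [Semiring k] [AddCommGroup M] [TopologicalSpace M]
    [IsTopologicalAddGroup M] [Module k M] [StarRing (M →L[k] M)] (R : Set (M →L[k] M)) :
    PartialOrder (Projections R) where
  le E F := Set.range E.op ⊆ Set.range F.op
  le_refl _ := Set.Subset.rfl
  le_trans _ _ _ := Set.Subset.trans
  le_antisymm E F hEF hFE := by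
    have key : ∀ P Q : Projections R, Set.range P.op ⊆ Set.range Q.op → Q.op * P.op = P.op := by
      intro P Q h
      ext v
      obtain ⟨w, hw⟩ := h ⟨v, rfl⟩
      change Q.op (P.op v) = P.op v
      rw [← hw]
      exact congrArg (fun T : M →L[k] M => T w) Q.isStarProjection.isIdempotentElem
    have h1 := congrArg star (key E F hEF)
    rw [star_mul, E.isStarProjection.isSelfAdjoint.star_eq,
      F.isStarProjection.isSelfAdjoint.star_eq] at h1
    exact Projections.ext (h1.symm.trans (key F E hFE))

/-! ### Component spaces -/

/-- The sphere `𝕊` of quaternionic imaginary units. -/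
abbrev ImagUnit : Type := {i : ℍ[ℝ] // i * i = -1}

/-- The identification of `ℂ` with the complex plane `ℂ_i` inside `ℍ`. -/
noncomputable def embC (i : ImagUnit) (z : ℂ) : ℍ[ℝ] := (z.re : ℍ[ℝ]) + (z.im : ℍ[ℝ]) * i

theorem ImagUnit.re_eq_zero (i : ImagUnit) : (i : ℍ[ℝ]).re = 0 := by
  obtain ⟨i, hi⟩ := i
  have h0 := congrArg QuaternionAlgebra.re hi
  have h1 := congrArg QuaternionAlgebra.imI hi
  have h2 := congrArg QuaternionAlgebra.imJ hi
  have h3 := congrArg QuaternionAlgebra.imK hi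
  simp at h0 h1 h2 h3
  by_contra hne
  have e1 : i.imI = 0 := by
    have : i.re * i.imI = 0 := by linarith
    simpa [hne] using this
  have e2 : i.imJ = 0 := by
    have : i.re * i.imJ = 0 := by linarith
    simpa [hne] using this
  have e3 : i.imK = 0 := by
    have : i.re * i.imK = 0 := by linarith
    simpa [hne] using this
  rw [e1, e2, e3] at h0
  nlinarith [sq_nonneg i.re]

theorem ImagUnit.norm_eq (i : ImagUnit) :
    (i : ℍ[ℝ]).imI ^ 2 + (i : ℍ[ℝ]).imJ ^ 2 + (i : ℍ[ℝ]).imK ^ 2 = 1 := by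
  have h0 := congrArg QuaternionAlgebra.re i.2
  have hr := i.re_eq_zero
  simp [hr] at h0
  linarith

theorem ImagUnit.star_eq (i : ImagUnit) : star (i : ℍ[ℝ]) = -i := by
  have hr := i.re_eq_zero
  apply Quaternion.ext <;> simp [hr]

/-- The component space `H⁺_{J,i} = {v | J v = v i}`. -/
def complexComponent (J : BoundedOp H) (i : ImagUnit) : AddSubgroup H where
  carrier := {v | J v = v <• (i : ℍ[ℝ])}
  add_mem' {u v} hu hv := by
    change J (u + v) = (u + v) <• (i : ℍ[ℝ])
    rw [map_add, smul_add, hu, hv]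
  zero_mem' := by change J 0 = (0 : H) <• (i : ℍ[ℝ]); simp
  neg_mem' {u} hu := by
    change J (-u) = (-u) <• (i : ℍ[ℝ])
    rw [map_neg, smul_neg, hu]

theorem embC_comm (i : ImagUnit) (z : ℂ) : embC i z * i = i * embC i z := by
  rw [embC, add_mul, mul_add, mul_assoc, Quaternion.coe_commutes z.re, ← mul_assoc (i : ℍ[ℝ]),
    ← Quaternion.coe_commutes z.im (i : ℍ[ℝ]), mul_assoc]

theorem embC_one (i : ImagUnit) : embC i 1 = 1 := by simp [embC]

theorem embC_zero (i : ImagUnit) : embC i 0 = 0 := by simp [embC]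

theorem embC_add (i : ImagUnit) (z w : ℂ) : embC i (z + w) = embC i z + embC i w := by
  simp only [embC, Complex.add_re, Complex.add_im, Quaternion.coe_add, add_mul]; abel

theorem embC_mul (i : ImagUnit) (z w : ℂ) : embC i (z * w) = embC i w * embC i z := by
  have hr := i.re_eq_zero
  have hn := i.norm_eq
  apply Quaternion.ext <;> simp [embC, hr] <;>
    first
    | linear_combination (w.im * z.im) * hn
    | ring

/-- `ℂ_i`-multiplication on `H⁺_{J,i}` is inherited from the right multiplication on `H`. -/
noncomputable instance instModuleComplexComponent (J : BoundedOp H) (i : ImagUnit) :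
    Module ℂ (complexComponent J i) where
  smul z v := ⟨(v : H) <• embC i z, by
    change J ((v : H) <• embC i z) = ((v : H) <• embC i z) <• (i : ℍ[ℝ])
    have hv : J (v : H) = (v : H) <• (i : ℍ[ℝ]) := v.2
    rw [J.map_smul, hv, smul_smul, smul_smul, ← MulOpposite.op_mul, ← MulOpposite.op_mul,
      embC_comm]⟩
  one_smul v := Subtype.ext (by
    change (v : H) <• embC i 1 = v
    rw [embC_one, MulOpposite.op_one, one_smul])
  mul_smul z w v := Subtype.ext (by
    change (v : H) <• embC i (z * w) = ((v : H) <• embC i w) <• embC i z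
    rw [embC_mul, MulOpposite.op_mul, mul_smul])
  smul_zero z := Subtype.ext (smul_zero (MulOpposite.op (embC i z)))
  smul_add z u v := Subtype.ext (smul_add (MulOpposite.op (embC i z)) (u : H) (v : H))
  add_smul z w v := Subtype.ext (by
    change (v : H) <• embC i (z + w) = (v : H) <• embC i z + (v : H) <• embC i w
    rw [embC_add, MulOpposite.op_add, add_smul])
  zero_smul v := Subtype.ext (by
    change (v : H) <• embC i 0 = 0
    rw [embC_zero, MulOpposite.op_zero, zero_smul])

theorem coe_complex_smul (J : BoundedOp H) (i : ImagUnit) (z : ℂ) (v : complexComponent J i) :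
    ((z • v : complexComponent J i) : H) = (v : H) <• embC i z := rfl

/-- The `ℂ_i`-component of a quaternion, read in `ℂ`. -/
noncomputable def projC (i : ImagUnit) (q : ℍ[ℝ]) : ℂ := ⟨q.re, -((i : ℍ[ℝ]) * q).re⟩

theorem projC_embC (i : ImagUnit) (z : ℂ) : projC i (embC i z) = z := by
  have hr := i.re_eq_zero
  have hn := i.norm_eq
  apply Complex.ext
  · simp [projC, embC, hr]
  · simp [projC, embC, hr]
    linear_combination z.im * hn

/-- The complex Hilbert space structure of `H⁺_{J,i}`. The scalar product is the one of `H`, whose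
values on `H⁺_{J,i}` lie in `ℂ_i` when `J` is unitary, read in `ℂ`. -/
noncomputable instance instInnerProductSpaceComplexComponent (J : BoundedOp H) (i : ImagUnit) :
    InnerProductSpace ℂ (complexComponent J i) where
  norm_smul_le z v := by
    have hr := i.re_eq_zero
    have hn := i.norm_eq
    have h : ‖embC i z‖ = ‖z‖ := by
      have h2 : ‖embC i z‖ * ‖embC i z‖ = ‖z‖ * ‖z‖ := by
        rw [← Quaternion.normSq_eq_norm_mul_self, Complex.norm_mul_self_eq_normSq,
          Quaternion.normSq_def', Complex.normSq_apply]
        simp [embC, hr]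
        linear_combination (z.im ^ 2) * hn
      exact (mul_self_inj (norm_nonneg _) (norm_nonneg _)).1 h2
    change ‖(v : H) <• embC i z‖ ≤ ‖z‖ * ‖(v : H)‖
    rw [norm_smul_right, h, mul_comm]
  inner u v := projC i (qinner (u : H) (v : H))
  norm_sq_eq_re_inner v := by
    change ‖(v : H)‖ ^ 2 = (qinner (v : H) (v : H)).re
    rw [qinner_self, Quaternion.re_coe]
  conj_inner_symm u v := by
    rw [← star_qinner]
    have hr := i.re_eq_zero
    apply Complex.ext <;> simp [projC, hr] <;> ring
  add_left u v w := by
    change projC i (qinner ((u : H) + (v : H)) (w : H)) = _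
    rw [qinner_add_left]
    apply Complex.ext <;> simp [projC] <;> ring
  smul_left u v z := by
    change projC i (qinner ((u : H) <• embC i z) (v : H)) = _
    rw [qinner_smul_left]
    have hr := i.re_eq_zero
    have hn := i.norm_eq
    apply Complex.ext
    · simp [projC, embC, hr]; ring
    · simp [projC, embC, hr]
      linear_combination (-z.im * (qinner (u : H) (v : H)).re) * hn

theorem complex_inner_def (J : BoundedOp H) (i : ImagUnit) (u v : complexComponent J i) :
    inner ℂ u v = projC i (qinner (u : H) (v : H)) := rfl

instance instCompleteSpaceComplexComponent (J : BoundedOp H) (i : ImagUnit) :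
    CompleteSpace (complexComponent J i) := by
  have h : IsClosed ((complexComponent J i : AddSubgroup H) : Set H) :=
    isClosed_eq J.continuous (continuous_const_smul (MulOpposite.op (i : ℍ[ℝ])))
  exact h.completeSpace_coe

/-- The component space `H_ℝ = {v | I v = v i, J v = v j}`, with the real scalar product
inherited from `H`. -/
def realComponent (I J : BoundedOp H) (i j : ImagUnit) : Submodule ℝ H where
  carrier := {v | I v = v <• (i : ℍ[ℝ]) ∧ J v = v <• (j : ℍ[ℝ])}
  add_mem' {u v} hu hv := by
    refine ⟨?_, ?_⟩
    · rw [map_add, smul_add, hu.1, hv.1]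
    · rw [map_add, smul_add, hu.2, hv.2]
  zero_mem' := by simp
  smul_mem' r v hv := by
    refine ⟨?_, ?_⟩
    · rw [← smul_comm r (MulOpposite.op (i : ℍ[ℝ])) v, ← hv.1]
      exact (I.restrictScalars ℝ).map_smul r v
    · rw [← smul_comm r (MulOpposite.op (j : ℍ[ℝ])) v, ← hv.2]
      exact (J.restrictScalars ℝ).map_smul r v

instance instCompleteSpaceRealComponent (I J : BoundedOp H) (i j : ImagUnit) :
    CompleteSpace (realComponent I J i j) := by
  have h : IsClosed ((realComponent I J i j : Submodule ℝ H) : Set H) :=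
    (isClosed_eq I.continuous (continuous_const_smul (MulOpposite.op (i : ℍ[ℝ])))).inter
      (isClosed_eq J.continuous (continuous_const_smul (MulOpposite.op (j : ℍ[ℝ]))))
  exact h.completeSpace_coe

/-- `R` is identified with `𝓑 V`, for a real or complex Hilbert space `V` that sits in `H` by `ι`,
through quaternionic linear extension, that is:
* every bounded operator on `V` has exactly one extension to a bounded right linear operator on `H`;
* `R` consists of the operators that extend a bounded operator on `V`;
* restriction to `V` is an isomorphism of real `*`-algebras from `R` onto `𝓑 V`;
* restriction to `V` is an isomorphism of the lattices of orthogonal projections that respects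
  orthocomplements. -/
structure IsQuaternionicExtension {k V : Type*} [RCLike k] [NormedAddCommGroup V]
    [InnerProductSpace k V] [CompleteSpace V]
    (R : StarSubalgebra ℝ (BoundedOp H)) (ι : V → H) : Prop where
  existsUnique_extension : ∀ S : V →L[k] V, ∃! T : BoundedOp H, ∀ v, T (ι v) = ι (S v)
  mem_iff : ∀ T : BoundedOp H, T ∈ R ↔ ∃ S : V →L[k] V, ∀ v, T (ι v) = ι (S v)
  algebraIso : ∃ Φ : R ≃+* (V →L[k] V),
    (∀ (a : ℝ) (T : R), Φ (a • T) = (a : k) • Φ T) ∧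
    (∀ T : R, Φ (star T) = star (Φ T)) ∧
    ∀ (T : R) (v : V), (T : BoundedOp H) (ι v) = ι (Φ T v)
  latticeIso : ∃ Ψ : Projections (R : Set (BoundedOp H)) ≃o
      Projections (Set.univ : Set (V →L[k] V)),
    (∀ E v, E.op (ι v) = ι ((Ψ E).op v)) ∧
    ∀ E F, F.op = (1 : BoundedOp H) - E.op → (Ψ F).op = (1 : V →L[k] V) - (Ψ E).op

end QuatHilbert

open QuatHilbert

/-! The engine is a Schur lemma over `ℝ`, followed by Frobenius' argument. If `A` lies in the
commutant of an irreducible family, its kernel is a closed invariant subspace, so `A * B = 0` forces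
`A = 0` or `B = 0` (`eq_zero_or_eq_zero_of_mul_eq_zero`). No spectral theorem is needed to conclude
that a self-adjoint `T` in the commutant is a real scalar. After scaling, `T * T` has a positive
square root `P` that commutes with `T` and stays in the commutant, and `(T - P) * (T + P) = 0` gives
`T = P` or `T = -P`. Thus every `T - r` is semidefinite, so the quadratic form of `T` is constant on
the unit sphere (`eq_smul_one_of_noZeroDivisors`).

A real `*`-algebra with only scalar self-adjoint elements, and with `star a * a` positive for `a ≠
0`, is spanned by `1`, by `1, J`, or by `1, I, J, I * J` with anticommuting skew roots of `-1`
(`HasScalarSelfAdjoints.trichotomy`). Real dimensions 1, 2, 4 keep the types apart.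

By the bicommutant property, `R` is then everything, the commutant of `J`, or the commutant of `I,
J`. In the second case `H` is the direct sum of `H⁺` and `H⁺ j` for a unit `j` anticommuting with
`i`; in the third it is the sum of `H_ℝ e` over `e = 1, i, j, ij`. Explicit averaging projections
give these decompositions, hence existence and uniqueness of extensions. Operators in `R` are
exactly those preserving the component, and `IsQuaternionicExtension.of_restriction` turns this into
the algebra and lattice isomorphisms. -/

/-! ### Square roots in real Banach algebras -/

section SquareRoot

variable {A : Type*} [NormedRing A] [NormedAlgebra ℝ A]

/-- The iteration `y ↦ (x + y ^ 2) / 2`, whose fixed points `y` satisfy `(1 - y) ^ 2 = 1 - x`. -/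
noncomputable def sqrtIter (x : A) : ℕ → A
  | 0 => 0
  | n + 1 => (1 / 2 : ℝ) • (x + sqrtIter x n * sqrtIter x n)

theorem sqrtIter_real_nonneg (n : ℕ) : 0 ≤ sqrtIter (1 : ℝ) n := by
  induction n with
  | zero => simp [sqrtIter]
  | succ n ih => simp only [sqrtIter, smul_eq_mul]; positivity

theorem sqrtIter_real_le_one (n : ℕ) : sqrtIter (1 : ℝ) n ≤ 1 := by
  induction n with
  | zero => simp [sqrtIter]
  | succ n ih =>
    have := sqrtIter_real_nonneg n
    simp only [sqrtIter, smul_eq_mul]; nlinarith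

/-- The iterates are polynomials in `x` with nonnegative coefficients, so the scalar iteration at
`1` majorises them. -/
theorem norm_sqrtIter_le {x : A} (hx : ‖x‖ ≤ 1) (n : ℕ) :
    ‖sqrtIter x n‖ ≤ sqrtIter (1 : ℝ) n := by
  induction n with
  | zero => simp [sqrtIter]
  | succ n ih =>
    simp only [sqrtIter, smul_eq_mul]
    rw [norm_smul, Real.norm_of_nonneg (by norm_num)]
    gcongr
    refine (norm_add_le _ _).trans (add_le_add hx ((norm_mul_le _ _).trans ?_))
    gcongr
    exact sqrtIter_real_nonneg n

theorem norm_sqrtIter_succ_sub_le {x : A} (hx : ‖x‖ ≤ 1) (n : ℕ) :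
    ‖sqrtIter x (n + 1) - sqrtIter x n‖ ≤ sqrtIter (1 : ℝ) (n + 1) - sqrtIter (1 : ℝ) n := by
  induction n with
  | zero =>
    simp only [sqrtIter, mul_zero, add_zero, sub_zero, smul_eq_mul, mul_one, norm_smul]
    rw [Real.norm_of_nonneg (by norm_num)]
    linarith
  | succ n ih =>
    -- The difference of squares is split as `y' * (y' - y) + (y' - y) * y`; the same splitting for
    -- the scalar iteration allows a bound term by term.
    have e : sqrtIter x (n + 2) - sqrtIter x (n + 1) = (1 / 2 : ℝ) •
        (sqrtIter x (n + 1) * (sqrtIter x (n + 1) - sqrtIter x n) +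
          (sqrtIter x (n + 1) - sqrtIter x n) * sqrtIter x n) := by
      rw [sqrtIter, sqrtIter.eq_2 x n, ← smul_sub, ← sqrtIter.eq_2 x n]
      congr 1
      noncomm_ring
    have e' : sqrtIter (1 : ℝ) (n + 2) - sqrtIter (1 : ℝ) (n + 1) = (1 / 2 : ℝ) *
        (sqrtIter (1 : ℝ) (n + 1) * (sqrtIter (1 : ℝ) (n + 1) - sqrtIter (1 : ℝ) n) +
          (sqrtIter (1 : ℝ) (n + 1) - sqrtIter (1 : ℝ) n) * sqrtIter (1 : ℝ) n) := by
      rw [sqrtIter, sqrtIter.eq_2 (1 : ℝ) n, ← smul_sub, ← sqrtIter.eq_2 (1 : ℝ) n, smul_eq_mul]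
      ring
    rw [e, e', norm_smul, Real.norm_of_nonneg (by norm_num)]
    have h0 := sqrtIter_real_nonneg (n + 1)
    gcongr
    refine (norm_add_le _ _).trans (add_le_add ((norm_mul_le _ _).trans ?_)
      ((norm_mul_le _ _).trans ?_))
    · gcongr
      exact norm_sqrtIter_le hx _
    · gcongr
      · exact (norm_nonneg _).trans ih
      · exact norm_sqrtIter_le hx _

/-- The majorising increments telescope and their sums are at most `1`, so the iterates are Cauchy
even in the boundary case `‖x‖ = 1`. They remain in the closed subalgebra `D`, hence so does the
limit, which is a fixed point. -/
theorem exists_one_sub_mul_self_eq [CompleteSpace A] (D : Subalgebra ℝ A)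
    (hD : IsClosed (D : Set A)) {x : A} (hxD : x ∈ D) (hx : ‖x‖ ≤ 1) :
    ∃ y ∈ D, ‖y‖ ≤ 1 ∧ (1 - y) * (1 - y) = 1 - x := by
  have hmem : ∀ n, sqrtIter x n ∈ D := by
    intro n
    induction n with
    | zero => exact D.zero_mem
    | succ n ih => exact D.smul_mem (D.add_mem hxD (D.mul_mem ih ih)) _
  have hsum : Summable fun n => sqrtIter (1 : ℝ) (n + 1) - sqrtIter (1 : ℝ) n := by
    refine summable_of_sum_range_le (c := 1)
      (fun n => (norm_nonneg _).trans (norm_sqrtIter_succ_sub_le hx n)) fun n => ?_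
    rw [Finset.sum_range_sub]
    simpa [sqrtIter] using sqrtIter_real_le_one n
  have hc : CauchySeq (sqrtIter x) :=
    cauchySeq_of_dist_le_of_summable _
      (fun n => by rw [dist_comm, dist_eq_norm]; exact norm_sqrtIter_succ_sub_le hx n) hsum
  obtain ⟨y, hy⟩ := cauchySeq_tendsto_of_complete hc
  refine ⟨y, hD.mem_of_tendsto hy (.of_forall hmem), le_of_tendsto hy.norm
    (.of_forall fun n => (norm_sqrtIter_le hx n).trans (sqrtIter_real_le_one n)), ?_⟩
  have h1 : Filter.Tendsto (fun n => sqrtIter x (n + 1)) Filter.atTop (nhds y) :=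
    hy.comp (Filter.tendsto_add_atTop_nat 1)
  have h2 : Filter.Tendsto (fun n => sqrtIter x (n + 1)) Filter.atTop
      (nhds ((1 / 2 : ℝ) • (x + y * y))) :=
    (tendsto_const_nhds.add (hy.mul hy)).const_smul _
  have h3 : (2 : ℝ) • y = x + y * y := by
    conv_lhs => rw [tendsto_nhds_unique h1 h2, smul_smul]
    norm_num
  rw [two_smul] at h3
  calc (1 - y) * (1 - y) = 1 - (y + y) + y * y := by noncomm_ring
    _ = 1 - x := by rw [h3]; abel

end SquareRoot

/-! ### Self-adjoint operators in a commutant without zero divisors -/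

section SelfAdjoint

variable {H : Type*} [NormedAddCommGroup H] [InnerProductSpace ℝ H] [CompleteSpace H]

/-- Expanding the square gives `‖v‖² - 2‖T v‖² + ‖T (T v)‖²`, and the last term is at most `‖T v‖²`.
This makes `1 - T * T` an admissible input for the square root iteration. -/
theorem norm_one_sub_mul_self_le {T : H →L[ℝ] H} (hT : IsSelfAdjoint T) (h1 : ‖T‖ ≤ 1) :
    ‖1 - T * T‖ ≤ 1 := by
  refine ContinuousLinearMap.opNorm_le_bound _ zero_le_one fun v => ?_
  rw [one_mul]
  refine le_of_sq_le_sq ?_ (norm_nonneg _)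
  change ‖v - T (T v)‖ ^ 2 ≤ ‖v‖ ^ 2
  have h2 : inner ℝ v (T (T v)) = ‖T v‖ ^ 2 := by
    rw [← real_inner_self_eq_norm_sq]
    exact (hT.isSymmetric v (T v)).symm
  have h3 : ‖T (T v)‖ ≤ ‖T v‖ :=
    (T.le_of_opNorm_le h1 _).trans_eq (one_mul _)
  rw [norm_sub_sq_real, h2]
  nlinarith [norm_nonneg (T (T v)), norm_nonneg (T v)]

/-- In a closed algebra of operators that contains no zero divisors, a self-adjoint operator has a
semidefinite quadratic form. -/
theorem inner_nonneg_or_nonpos_of_noZeroDivisors (D : Set (H →L[ℝ] H))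
    (hD : ∀ A ∈ D.centralizer, ∀ B ∈ D.centralizer, A * B = 0 → A = 0 ∨ B = 0)
    {T : H →L[ℝ] H} (hTD : T ∈ D.centralizer) (hT : IsSelfAdjoint T) :
    (∀ v, 0 ≤ inner ℝ v (T v)) ∨ ∀ v, inner ℝ v (T v) ≤ 0 := by
  wlog h1 : ‖T‖ ≤ 1 generalizing T
  · have hpos : 0 < ‖T‖ := lt_trans one_pos (not_le.1 h1)
    have := @this (‖T‖⁻¹ • T) (Set.smul_mem_centralizer _ hTD)
      (IsSelfAdjoint.smul (by simp [IsSelfAdjoint]) hT)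
      (by rw [norm_smul, norm_inv, norm_norm, inv_mul_cancel₀ hpos.ne'])
    have e : ∀ v, inner ℝ v ((‖T‖⁻¹ • T) v) = ‖T‖⁻¹ * inner ℝ v (T v) := fun v => by
      rw [smul_apply, inner_smul_right]
    have hi := inv_pos.2 hpos
    refine this.imp (fun h v => ?_) (fun h v => ?_)
    · exact nonneg_of_mul_nonneg_right ((h v).trans_eq (e v)) hi
    · exact nonpos_of_mul_nonpos_right ((e v).symm.trans_le (h v)) hi
  -- Here `1 - y` is the square root of `T * T`. Working in the centralizer of `insert T D`, which
  -- contains `T`, makes `y` commute with `T` as well as with `D`.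
  obtain ⟨y, hy, hy1, hyx⟩ := exists_one_sub_mul_self_eq
    (Subalgebra.centralizer ℝ (insert T D)) (Set.isClosed_centralizer _) (x := 1 - T * T)
    (by
      have : T ∈ Subalgebra.centralizer ℝ (insert T D) := by
        rintro A (rfl | hA)
        · rfl
        · exact hTD A hA
      exact sub_mem (one_mem _) (mul_mem this this))
    (norm_one_sub_mul_self_le hT h1)
  rw [sub_sub_cancel] at hyx
  have hyT : T * y = y * T := hy T (Set.mem_insert _ _)
  have hyD : y ∈ Subalgebra.centralizer ℝ D := fun A hA => hy A (Set.mem_insert_of_mem _ hA)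
  have hTD' : T ∈ Subalgebra.centralizer ℝ D := hTD
  -- The bound `‖y‖ ≤ 1` makes this square root positive.
  have hpos : ∀ v, 0 ≤ inner ℝ v ((1 - y) v) := fun v => by
    change 0 ≤ inner ℝ v (v - y v)
    rw [inner_sub_right, real_inner_self_eq_norm_sq, sub_nonneg, sq]
    refine (real_inner_le_norm _ _).trans ?_
    gcongr
    exact (y.le_of_opNorm_le hy1 _).trans_eq (one_mul _)
  have hprod : (T - (1 - y)) * (T + (1 - y)) = 0 := by
    have : (T - (1 - y)) * (T + (1 - y)) = T * T - (1 - y) * (1 - y) + (y * T - T * y) := by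
      noncomm_ring
    rw [this, hyx, hyT, sub_self, sub_self, add_zero]
  rcases hD _ (sub_mem hTD' (sub_mem (one_mem _) hyD)) _ (add_mem hTD' (sub_mem (one_mem _) hyD))
    hprod with h | h
  · left
    rw [sub_eq_zero.1 h]
    exact hpos
  · right
    intro v
    rw [eq_neg_of_add_eq_zero_left h, neg_apply, inner_neg_right]
    exact neg_nonpos.2 (hpos v)

/-- If the Rayleigh quotient of `T` took two values, then `T - r` would be indefinite for any `r`
strictly between them. So the quotient is constant, and a self-adjoint operator with zero quadratic
form vanishes. -/
theorem eq_smul_one_of_noZeroDivisors (D : Set (H →L[ℝ] H))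
    (hD : ∀ A ∈ D.centralizer, ∀ B ∈ D.centralizer, A * B = 0 → A = 0 ∨ B = 0)
    {T : H →L[ℝ] H} (hTD : T ∈ D.centralizer) (hT : IsSelfAdjoint T) :
    ∃ r : ℝ, T = r • (1 : H →L[ℝ] H) := by
  rcases subsingleton_or_nontrivial H with hH | hH
  · exact ⟨0, ContinuousLinearMap.ext fun v => Subsingleton.elim _ _⟩
  have hTD' : T ∈ Subalgebra.centralizer ℝ D := hTD
  have hself : ∀ r : ℝ, IsSelfAdjoint (T - r • (1 : H →L[ℝ] H)) := fun r =>
    hT.sub (IsSelfAdjoint.smul (by simp [IsSelfAdjoint]) (IsSelfAdjoint.one _))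
  have hform : ∀ (r : ℝ) v, inner ℝ v ((T - r • (1 : H →L[ℝ] H)) v) =
      inner ℝ v (T v) - r * ‖v‖ ^ 2 := fun r v => by
    change inner ℝ v (T v - r • v) = _
    rw [inner_sub_right, inner_smul_right, real_inner_self_eq_norm_sq]
  have hdich : ∀ r : ℝ, (∀ v, r * ‖v‖ ^ 2 ≤ inner ℝ v (T v)) ∨
      ∀ v, inner ℝ v (T v) ≤ r * ‖v‖ ^ 2 := fun r => by
    have := inner_nonneg_or_nonpos_of_noZeroDivisors D hD (T := T - r • 1)
      (sub_mem hTD' (Subalgebra.smul_mem _ (one_mem _) r)) (hself r)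
    simpa only [hform, sub_nonneg, sub_nonpos] using this
  obtain ⟨v₀, hv₀⟩ := exists_ne (0 : H)
  have hv₀' : 0 < ‖v₀‖ ^ 2 := by positivity
  set r : ℝ := inner ℝ v₀ (T v₀) / ‖v₀‖ ^ 2 with hr
  have hrv : inner ℝ v₀ (T v₀) = r * ‖v₀‖ ^ 2 := by rw [hr]; field_simp
  have key : ∀ v, inner ℝ v (T v) = r * ‖v‖ ^ 2 := by
    intro v
    rcases eq_or_ne v 0 with rfl | hv
    · simp
    have hv' : 0 < ‖v‖ ^ 2 := by positivity
    set s : ℝ := inner ℝ v (T v) / ‖v‖ ^ 2 with hs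
    have hsv : inner ℝ v (T v) = s * ‖v‖ ^ 2 := by rw [hs]; field_simp
    rw [hsv]
    congr 1
    -- For unequal values the midpoint `(s + r) / 2` contradicts semidefiniteness, tested at `v` and
    -- at `v₀`.
    rcases lt_trichotomy s r with h | h | h
    · exfalso
      rcases hdich ((s + r) / 2) with h' | h'
      · have := h' v; rw [hsv] at this; have := le_of_mul_le_mul_right this hv'; linarith
      · have := h' v₀; rw [hrv] at this; have := le_of_mul_le_mul_right this hv₀'; linarith
    · exact h
    · exfalso
      rcases hdich ((s + r) / 2) with h' | h'
      · have := h' v₀; rw [hrv] at this; have := le_of_mul_le_mul_right this hv₀'; linarith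
      · have := h' v; rw [hsv] at this; have := le_of_mul_le_mul_right this hv'; linarith
  refine ⟨r, sub_eq_zero.1 ?_⟩
  have h0 := (hself r).isSymmetric.inner_map_self_eq_zero.1 fun v => by
    change inner ℝ ((T - r • (1 : H →L[ℝ] H)) v) v = 0
    rw [real_inner_comm, hform, key, sub_self]
  exact ContinuousLinearMap.ext fun v => LinearMap.congr_fun h0 v

end SelfAdjoint

/-! ### Real star algebras whose self-adjoint elements are scalars -/

/-- Every self-adjoint element is a real scalar, and `star a * a` is a positive scalar for
`a ≠ 0`. -/
structure HasScalarSelfAdjoints (A : Type*) [Ring A] [Algebra ℝ A] [StarRing A] : Prop where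
  exists_eq_smul : ∀ a : A, IsSelfAdjoint a → ∃ r : ℝ, a = r • (1 : A)
  exists_pos : ∀ a : A, a ≠ 0 → ∃ r : ℝ, 0 < r ∧ star a * a = r • (1 : A)

namespace HasScalarSelfAdjoints

variable {A : Type*} [Ring A] [Algebra ℝ A] [StarRing A]
  (hA : HasScalarSelfAdjoints A)

include hA

/-- For skew `C`, `C * C = -(star C * C)` is a negative scalar `-s`; dividing by `√s` normalises it.
-/
theorem exists_smul_sq_eq_neg_one {C : A} (hC : star C = -C) (h0 : C ≠ 0) :
    ∃ r : ℝ, r ≠ 0 ∧ (r • C) * (r • C) = -1 := by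
  obtain ⟨s, hs, h⟩ := hA.exists_pos C h0
  rw [hC, neg_mul] at h
  refine ⟨(√s)⁻¹, inv_ne_zero (Real.sqrt_pos.2 hs).ne', ?_⟩
  rw [smul_mul_smul_comm, ← neg_neg (C * C), h, ← mul_inv, Real.mul_self_sqrt hs.le, smul_neg,
    smul_smul, inv_mul_cancel₀ hs.ne', one_smul]

/-- A Gram–Schmidt step: the anticommutator `C * J + J * C` is self-adjoint, hence a scalar `s`, and
`J * J = -1` means that adding `(s / 2) • J` to `C` cancels it. -/
theorem exists_sub_smul_anticomm {C J : A} (hC : star C = -C) (hJ : star J = -J)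
    (hJ2 : J * J = -1) : ∃ t : ℝ, (C - t • J) * J = -(J * (C - t • J)) := by
  obtain ⟨s, hs⟩ := hA.exists_eq_smul (C * J + J * C) (by
    rw [IsSelfAdjoint, star_add, star_mul, star_mul, hC, hJ]
    noncomm_ring)
  refine ⟨-(s / 2), eq_neg_of_add_eq_zero_left ?_⟩
  have : (C - -(s / 2) • J) * J + J * (C - -(s / 2) • J) = (C * J + J * C) + s • (J * J) := by
    rw [sub_mul, mul_sub, smul_mul_assoc, mul_smul_comm]
    module
  rw [this, hs, hJ2]
  module

variable [StarModule ℝ A]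

theorem exists_add_skew (x : A) : ∃ (a : ℝ) (C : A), star C = -C ∧ x = a • (1 : A) + C := by
  obtain ⟨r, hr⟩ := hA.exists_eq_smul (x + star x) (IsSelfAdjoint.add_star_self x)
  refine ⟨r / 2, x - (r / 2) • (1 : A), ?_, by abel⟩
  have h : star x = r • (1 : A) - x := by rw [← hr]; abel
  rw [star_sub, star_smul, star_one, h, star_trivial]
  have : r • (1 : A) = (r / 2) • (1 : A) + (r / 2) • (1 : A) := by rw [← add_smul]; ring_nf
  rw [this]; abel

/-- `1, I, J, IJ` span if `I, J` are anticommuting skew roots of `-1`. -/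
theorem exists_eq_quaternion {I J : A} (hI : star I = -I) (hJ : star J = -J) (hI2 : I * I = -1)
    (hJ2 : J * J = -1) (hIJ : I * J = -(J * I)) (x : A) :
    ∃ a b c d : ℝ, x = a • (1 : A) + b • I + c • J + d • (I * J) := by
  obtain ⟨a, C, hC, rfl⟩ := hA.exists_add_skew x
  obtain ⟨b, hb⟩ := hA.exists_sub_smul_anticomm hC hI hI2
  have hC1 : star (C - b • I) = -(C - b • I) := by
    rw [star_sub, star_smul, hC, hI, star_trivial]; module
  obtain ⟨c, hc⟩ := hA.exists_sub_smul_anticomm hC1 hJ hJ2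
  have hC2 : star (C - b • I - c • J) = -(C - b • I - c • J) := by
    rw [star_sub, star_smul, hC1, hJ, star_trivial]; module
  have hKs : star (I * J) = -(I * J) := by rw [star_mul, hI, hJ, hIJ]; noncomm_ring
  have hJI : J * I = -(I * J) := by rw [hIJ, neg_neg]
  have hK2 : (I * J) * (I * J) = -1 := by
    rw [mul_assoc, ← mul_assoc J, hJI, neg_mul, mul_neg, mul_assoc, hJ2, mul_neg, mul_one, mul_neg,
      neg_neg, hI2]
  obtain ⟨d, hd⟩ := hA.exists_sub_smul_anticomm hC2 hKs hK2
  refine ⟨a, b, c, d, ?_⟩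
  -- The residue `E` anticommutes with `I` and `J`, so it commutes with `I * J`; by the choice of
  -- `d` it also anticommutes with `I * J`. Since `I * J` is invertible, `E = 0`.
  set E := C - b • I - c • J - d • (I * J) with hE
  have hEI : E * I = -(I * E) := by
    have h1 : E = (C - b • I) - c • J - d • (I * J) := hE
    rw [h1, sub_mul, sub_mul, mul_sub, mul_sub, hb, smul_mul_assoc, smul_mul_assoc, mul_smul_comm,
      mul_smul_comm, mul_assoc, hJI, mul_neg]
    module
  have hEJ : E * J = -(J * E) := by
    have h1 : E = (C - b • I - c • J) - d • (I * J) := hE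
    rw [h1, sub_mul, mul_sub, hc, smul_mul_assoc, mul_smul_comm, ← mul_assoc J, hJI, neg_mul]
    module
  have hEK : E * (I * J) = (I * J) * E := by
    rw [← mul_assoc, hEI, neg_mul, mul_assoc, hEJ, mul_neg, neg_neg, mul_assoc]
  have h2 : (2 : ℝ) • (E * (I * J)) = 0 := by
    rw [two_smul]
    nth_rewrite 2 [hEK]
    rw [hd, neg_add_cancel]
  have h3 : E * (I * J) = 0 := (smul_eq_zero_iff_right two_ne_zero).1 h2
  have h4 : E = 0 := by
    have := congrArg (· * (I * J)) h3
    simpa only [mul_assoc E, hK2, zero_mul, mul_neg, mul_one, neg_eq_zero] using this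
  have h5 : C = E + b • I + c • J + d • (I * J) := by rw [hE]; abel
  rw [h5, h4]
  abel

/-- An element outside the span of `1, J` has a skew part which, made to anticommute with `J`, is
still nonzero; normalised, it is the required `I`. -/
theorem exists_eq_complex_or_exists_anticomm {J : A} (hJ : star J = -J) (hJ2 : J * J = -1) :
    (∀ x : A, ∃ a b : ℝ, x = a • (1 : A) + b • J) ∨
      ∃ I : A, star I = -I ∧ I * I = -1 ∧ I * J = -(J * I) := by
  by_contra! h
  obtain ⟨⟨x, hx⟩, h⟩ := h
  obtain ⟨a, C, hC, rfl⟩ := hA.exists_add_skew x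
  obtain ⟨t, ht⟩ := hA.exists_sub_smul_anticomm hC hJ hJ2
  have hC1 : star (C - t • J) = -(C - t • J) := by
    rw [star_sub, star_smul, hC, hJ, star_trivial]; module
  have h0 : C - t • J ≠ 0 := fun h0 => hx a t (by rw [sub_eq_zero.1 h0])
  obtain ⟨r, -, hr⟩ := hA.exists_smul_sq_eq_neg_one hC1 h0
  refine h (r • (C - t • J)) ?_ hr ?_
  · rw [star_smul, hC1, star_trivial, smul_neg]
  · rw [smul_mul_assoc, ht, mul_smul_comm, smul_neg]

theorem trichotomy :
    (∀ x : A, ∃ a : ℝ, x = a • (1 : A)) ∨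
      (∃ J : A, star J = -J ∧ J * J = -1 ∧ ∀ x : A, ∃ a b : ℝ, x = a • (1 : A) + b • J) ∨
      ∃ I J : A, (star I = -I ∧ I * I = -1) ∧ (star J = -J ∧ J * J = -1) ∧ I * J = -(J * I) ∧
        ∀ x : A, ∃ a b c d : ℝ, x = a • (1 : A) + b • I + c • J + d • (I * J) := by
  by_cases h : ∀ C : A, star C = -C → C = 0
  · left
    intro x
    obtain ⟨a, C, hC, rfl⟩ := hA.exists_add_skew x
    exact ⟨a, by rw [h C hC, add_zero]⟩
  · right
    push Not at h
    obtain ⟨C, hC, h0⟩ := h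
    obtain ⟨r, -, hr⟩ := hA.exists_smul_sq_eq_neg_one hC h0
    have hJ : star (r • C) = -(r • C) := by rw [star_smul, hC, star_trivial, smul_neg]
    rcases hA.exists_eq_complex_or_exists_anticomm hJ hr with h | ⟨I, hI, hI2, hIJ⟩
    · exact .inl ⟨_, hJ, hr, h⟩
    · exact .inr ⟨I, _, ⟨hI, hI2⟩, ⟨hJ, hr⟩, hIJ, hA.exists_eq_quaternion hI hJ hI2 hr hIJ⟩

end HasScalarSelfAdjoints

/-! ### Recognising `ℝ`, `ℂ` and `ℍ` by generators -/

section AlgEquiv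

variable {A : Type*} [Ring A] [Algebra ℝ A] [Nontrivial A]

theorem nonempty_algEquiv_real (h : ∀ x : A, ∃ a : ℝ, x = a • (1 : A)) :
    Nonempty (A ≃ₐ[ℝ] ℝ) :=
  ⟨(AlgEquiv.ofBijective (Algebra.ofId ℝ A) ⟨(algebraMap ℝ A).injective, fun x => by
    obtain ⟨a, rfl⟩ := h x
    exact ⟨a, Algebra.algebraMap_eq_smul_one a⟩⟩).symm⟩

theorem nonempty_algEquiv_complex {J : A} (hJ2 : J * J = -1)
    (h : ∀ x : A, ∃ a b : ℝ, x = a • (1 : A) + b • J) : Nonempty (A ≃ₐ[ℝ] ℂ) :=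
  ⟨(AlgEquiv.ofBijective (Complex.lift ⟨J, hJ2⟩) ⟨(Complex.lift ⟨J, hJ2⟩).toRingHom.injective,
    fun x => by
      obtain ⟨a, b, rfl⟩ := h x
      exact ⟨⟨a, b⟩, by simp [Algebra.algebraMap_eq_smul_one]⟩⟩).symm⟩

/-- The relations give an algebra map out of `ℍ`. It is injective because `ℍ` is a division ring and
the target is nontrivial, so linear independence of `1, I, J, I * J` need not be checked. -/
theorem nonempty_algEquiv_quaternion {I J : A} (hI2 : I * I = -1) (hJ2 : J * J = -1)
    (hIJ : I * J = -(J * I))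
    (h : ∀ x : A, ∃ a b c d : ℝ, x = a • (1 : A) + b • I + c • J + d • (I * J)) :
    Nonempty (A ≃ₐ[ℝ] ℍ[ℝ]) := by
  let q : QuaternionAlgebra.Basis A (-1 : ℝ) 0 (-1) :=
    { i := I, j := J, k := I * J
      i_mul_i := by simp [hI2]
      j_mul_j := by simp [hJ2]
      i_mul_j := rfl
      j_mul_i := by simp [hIJ] }
  let f : ℍ[ℝ] →ₐ[ℝ] A := q.liftHom
  refine ⟨(AlgEquiv.ofBijective f ⟨f.toRingHom.injective, fun x => ?_⟩).symm⟩
  obtain ⟨a, b, c, d, rfl⟩ := h x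
  refine ⟨⟨a, b, c, d⟩, ?_⟩
  change q.lift _ = _
  simp [QuaternionAlgebra.Basis.lift, q, Algebra.algebraMap_eq_smul_one]

end AlgEquiv

/-! ### The three types are distinguished by real dimension -/

section FinrankExclusive

variable {A : Type*} [Semiring A] [Algebra ℝ A]

theorem not_algEquiv_real_complex (h : Nonempty (A ≃ₐ[ℝ] ℝ)) : ¬ Nonempty (A ≃ₐ[ℝ] ℂ) := by
  rintro ⟨e⟩
  have := (h.some.symm.trans e).toLinearEquiv.finrank_eq
  simp [Complex.finrank_real_complex] at this

theorem not_algEquiv_real_quaternion (h : Nonempty (A ≃ₐ[ℝ] ℝ)) :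
    ¬ Nonempty (A ≃ₐ[ℝ] ℍ[ℝ]) := by
  rintro ⟨e⟩
  have := (h.some.symm.trans e).toLinearEquiv.finrank_eq
  simp [Quaternion.finrank_eq_four] at this

theorem not_algEquiv_complex_quaternion (h : Nonempty (A ≃ₐ[ℝ] ℂ)) :
    ¬ Nonempty (A ≃ₐ[ℝ] ℍ[ℝ]) := by
  rintro ⟨e⟩
  have := (h.some.symm.trans e).toLinearEquiv.finrank_eq
  simp [Complex.finrank_real_complex, Quaternion.finrank_eq_four] at this

end FinrankExclusive

/-! ### Imaginary units of the quaternions -/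

namespace QuatHilbert

instance instStarModuleQuaternion : StarModule ℝ ℍ[ℝ] where
  star_smul r q := by rw [star_trivial r]; exact Quaternion.star_smul r q

theorem quaternion_hasScalarSelfAdjoints : HasScalarSelfAdjoints ℍ[ℝ] where
  exists_eq_smul a ha := ⟨a.re, by
    rw [← Algebra.algebraMap_eq_smul_one]; exact Quaternion.star_eq_self.1 ha⟩
  exists_pos a ha := ⟨Quaternion.normSq a,
    lt_of_le_of_ne Quaternion.normSq_nonneg (Quaternion.normSq_ne_zero.2 ha).symm, by
      rw [Quaternion.star_mul_self, ← Algebra.algebraMap_eq_smul_one]; rfl⟩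

/-- The same dichotomy applied to `ℍ` itself: if `1, i` spanned, `ℍ` would be commutative. -/
theorem ImagUnit.exists_anticomm (i : ImagUnit) :
    ∃ j : ImagUnit, (i : ℍ[ℝ]) * j = -((j : ℍ[ℝ]) * i) := by
  rcases quaternion_hasScalarSelfAdjoints.exists_eq_complex_or_exists_anticomm i.star_eq i.2
    with h | ⟨j, -, hj, hij⟩
  · exfalso
    have comm : ∀ x y : ℍ[ℝ], x * y = y * x := fun x y => by
      obtain ⟨a, b, rfl⟩ := h x
      obtain ⟨c, d, rfl⟩ := h y
      simp only [add_mul, mul_add, smul_mul_assoc, mul_smul_comm, one_mul, mul_one]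
      module
    have hk : ∀ x y : ℍ[ℝ], (x * y).imK = (y * x).imK := fun x y => by rw [comm x y]
    simp only [Quaternion.imK_mul] at hk
    have := hk ⟨0, 1, 0, 0⟩ ⟨0, 0, 1, 0⟩
    norm_num at this
  · exact ⟨⟨j, hj⟩, by rw [hij, neg_neg]⟩

theorem ImagUnit.anticomm_of_inner_eq_zero {i j : ImagUnit}
    (h : inner ℝ (i : ℍ[ℝ]) (j : ℍ[ℝ]) = 0) : (i : ℍ[ℝ]) * j = -((j : ℍ[ℝ]) * i) := by
  rw [Quaternion.inner_def, j.star_eq] at h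
  have hi := i.re_eq_zero
  have hj := j.re_eq_zero
  simp [hi, hj] at h
  apply Quaternion.ext <;> simp [hi, hj] <;> linarith

theorem ImagUnit.exists_eq_quaternion {i j : ImagUnit} (h : (i : ℍ[ℝ]) * j = -((j : ℍ[ℝ]) * i))
    (q : ℍ[ℝ]) : ∃ a b c d : ℝ, q = a • (1 : ℍ[ℝ]) + b • (i : ℍ[ℝ]) + c • (j : ℍ[ℝ]) +
      d • ((i : ℍ[ℝ]) * j) :=
  quaternion_hasScalarSelfAdjoints.exists_eq_quaternion i.star_eq j.star_eq i.2 j.2 h q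

open QuaternionicHilbertSpace

variable {H : Type*} [NormedAddCommGroup H] [QuaternionicHilbertSpace H]

/-! ### The commutant of an irreducible family -/

theorem mem_commutant_iff {R : StarSubalgebra ℝ (BoundedOp H)} {A : BoundedOp H} :
    A ∈ commutant R ↔ ∀ T ∈ R, T * A = A * T := Iff.rfl

/-- The commutant, as a real `*`-algebra. -/
noncomputable def commutantStar (R : StarSubalgebra ℝ (BoundedOp H)) :
    StarSubalgebra ℝ (BoundedOp H) where
  toSubalgebra := commutant R
  star_mem' {A} hA T hT := by
    have := congrArg star (mem_commutant_iff.1 hA _ (star_mem hT))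
    rwa [star_mul, star_mul, star_star, eq_comm] at this

/-- The kernel of `A` is closed and invariant under `R`, and it contains the range of `B`;
irreducibility leaves only the kernels `⊥` and `⊤`. -/
theorem eq_zero_or_eq_zero_of_mul_eq_zero {R : StarSubalgebra ℝ (BoundedOp H)}
    (hirr : IsIrreducibleFamily (R : Set (BoundedOp H))) {A B : BoundedOp H}
    (hA : A ∈ commutant R) (h : A * B = 0) : A = 0 ∨ B = 0 := by
  have hker : ∀ v, v ∈ LinearMap.ker (A : H →ₗ[(ℍ[ℝ])ᵐᵒᵖ] H) ↔ A v = 0 := fun v => Iff.rfl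
  have hAB : ∀ v, A (B v) = 0 := fun v => congrArg (fun T : BoundedOp H => T v) h
  rcases hirr (LinearMap.ker (A : H →ₗ[(ℍ[ℝ])ᵐᵒᵖ] H))
    (isClosed_singleton.preimage A.continuous) (fun T hT v hv => by
      have : T (A v) = A (T v) :=
        congrArg (fun T : BoundedOp H => T v) (mem_commutant_iff.1 hA T hT)
      rw [hker] at hv ⊢
      rw [← this, hv, map_zero]) with h0 | h0
  · right
    ext v
    have := (hker (B v)).2 (hAB v)
    rwa [h0] at this
  · left
    ext v
    exact (hker v).1 (h0 ▸ Submodule.mem_top)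

/-- Right multiplication by a quaternion, as a real linear operator. -/
noncomputable def rightMul (q : ℍ[ℝ]) : H →L[ℝ] H where
  toFun v := v <• q
  map_add' u v := smul_add _ u v
  map_smul' r v := (smul_comm r (MulOpposite.op q) v).symm
  cont := continuous_const_smul (MulOpposite.op q)

theorem rightMul_apply (q : ℍ[ℝ]) (v : H) : rightMul q v = v <• q := rfl

/-- A real linear operator that commutes with right multiplications is right linear. -/
noncomputable def ofCommute (T : H →L[ℝ] H) (h : ∀ (q : ℍ[ℝ]) v, T (v <• q) = T v <• q) :
    BoundedOp H where
  toFun := T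
  map_add' := map_add T
  map_smul' a v := h a.unop v
  cont := T.continuous

/-- The real linear operators that generate the commutant of `R` and right linearity. -/
def realGenerators (R : StarSubalgebra ℝ (BoundedOp H)) : Set (H →L[ℝ] H) :=
  Set.range rightMul ∪ (fun T : BoundedOp H => T.restrictScalars ℝ) '' R

/-- Commuting with all right multiplications is right linearity. The quaternionic commutant is
thereby a centralizer of real operators, to which the Schur argument over `ℝ` applies. -/
theorem exists_of_mem_centralizer {R : StarSubalgebra ℝ (BoundedOp H)} {A : H →L[ℝ] H}
    (hA : A ∈ (realGenerators R).centralizer) :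
    ∃ T ∈ commutant R, T.restrictScalars ℝ = A := by
  refine ⟨ofCommute A fun q v => ?_, fun T hT => ?_, rfl⟩
  · exact (congrArg (fun B : H →L[ℝ] H => B v) (hA (rightMul q) (.inl ⟨q, rfl⟩))).symm
  · ext v
    exact congrArg (fun B : H →L[ℝ] H => B v)
      (hA (T.restrictScalars ℝ) (.inr (Set.mem_image_of_mem _ hT)))

theorem restrictScalars_mem_centralizer {R : StarSubalgebra ℝ (BoundedOp H)} {A : BoundedOp H}
    (hA : A ∈ commutant R) : A.restrictScalars ℝ ∈ (realGenerators R).centralizer := by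
  rintro _ (⟨q, rfl⟩ | ⟨T, hT, rfl⟩)
  · ext v
    exact (A.map_smul (MulOpposite.op q) v).symm
  · ext v
    exact congrArg (fun B : BoundedOp H => B v) (mem_commutant_iff.1 hA T hT)

theorem exists_eq_smul_one_of_isSelfAdjoint {R : StarSubalgebra ℝ (BoundedOp H)}
    (hirr : IsIrreducibleFamily (R : Set (BoundedOp H))) {A : BoundedOp H}
    (hA : A ∈ commutant R) (hs : IsSelfAdjoint A) : ∃ r : ℝ, A = r • (1 : BoundedOp H) := by
  obtain ⟨r, hr⟩ := eq_smul_one_of_noZeroDivisors (realGenerators R) (fun S hS T hT hST => by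
    obtain ⟨S, hS', rfl⟩ := exists_of_mem_centralizer hS
    obtain ⟨T, -, rfl⟩ := exists_of_mem_centralizer hT
    have : S * T = 0 := restrictScalars_real_injective hST
    rcases eq_zero_or_eq_zero_of_mul_eq_zero hirr hS' this with rfl | rfl
    · exact .inl rfl
    · exact .inr rfl) (restrictScalars_mem_centralizer hA)
    (by
      rw [IsSelfAdjoint, ContinuousLinearMap.star_eq_adjoint, ← restrictScalars_star, hs.star_eq])
  refine ⟨r, restrictScalars_real_injective ?_⟩
  rw [hr]
  rfl

/-- Evaluating the form at `v` with `A v ≠ 0` gives `‖A v‖² = r ‖v‖²`. -/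
theorem star_mul_self_eq_smul {A : BoundedOp H} (h0 : A ≠ 0) {r : ℝ}
    (hr : star A * A = r • (1 : BoundedOp H)) : 0 < r := by
  obtain ⟨v, hv⟩ : ∃ v, A v ≠ 0 := by
    by_contra! h
    exact h0 (ContinuousLinearMap.ext h)
  have h1 : ‖A v‖ ^ 2 = r * ‖v‖ ^ 2 := by
    have h2 : star A (A v) = r • v := congrArg (fun T : BoundedOp H => T v) hr
    rw [← real_inner_self_eq_norm_sq, ← real_inner_self_eq_norm_sq, real_inner_def,
      ← qinner_star_apply, h2, ← real_inner_def, inner_smul_left]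
    rfl
  have h3 : 0 < r * ‖v‖ ^ 2 := by rw [← h1]; positivity
  exact pos_of_mul_pos_left h3 (by positivity)

theorem commutantStar_hasScalarSelfAdjoints {R : StarSubalgebra ℝ (BoundedOp H)}
    (hirr : IsIrreducibleFamily (R : Set (BoundedOp H))) :
    HasScalarSelfAdjoints (commutantStar R) where
  exists_eq_smul a ha := by
    obtain ⟨r, hr⟩ := exists_eq_smul_one_of_isSelfAdjoint hirr a.2 (congrArg Subtype.val ha)
    exact ⟨r, Subtype.ext hr⟩
  exists_pos a ha := by
    obtain ⟨r, hr⟩ := exists_eq_smul_one_of_isSelfAdjoint hirr (star a * a).2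
      (congrArg Subtype.val (IsSelfAdjoint.star_mul_self a))
    exact ⟨r, star_mul_self_eq_smul (fun h => ha (Subtype.ext h)) hr, Subtype.ext hr⟩

/-! ### The three types of commutants -/

theorem isUnitaryAntiSelfAdjoint_iff {J : BoundedOp H} :
    IsUnitaryAntiSelfAdjoint J ↔ star J = -J ∧ J * J = -1 := by
  rw [IsUnitaryAntiSelfAdjoint, Unitary.mem_iff, and_comm]
  refine and_congr_right fun h => ?_
  have h1 : -J * J = -(J * J) := neg_mul J J
  have h2 : J * -J = -(J * J) := mul_neg J J
  rw [h, h1, h2, and_self, neg_eq_iff_eq_neg]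

/-- The commutant of an irreducible family is `ℝ`, `ℂ` or `ℍ`, as an algebra of operators. -/
theorem commutant_trichotomy [Nontrivial H] {R : StarSubalgebra ℝ (BoundedOp H)}
    (hirr : IsIrreducibleFamily (R : Set (BoundedOp H))) :
    (Nonempty (commutant R ≃ₐ[ℝ] ℝ) ∧
        ∀ T ∈ commutant R, ∃ a : ℝ, T = a • (1 : BoundedOp H)) ∨
      (Nonempty (commutant R ≃ₐ[ℝ] ℂ) ∧
        ∃ J ∈ commutant R, IsUnitaryAntiSelfAdjoint J ∧
          ∀ T ∈ commutant R, ∃ a b : ℝ, T = a • (1 : BoundedOp H) + b • J) ∨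
      (Nonempty (commutant R ≃ₐ[ℝ] ℍ[ℝ]) ∧
        ∃ I ∈ commutant R, ∃ J ∈ commutant R, IsUnitaryAntiSelfAdjoint I ∧
          IsUnitaryAntiSelfAdjoint J ∧ I * J = -(J * I) ∧
          ∀ T ∈ commutant R, ∃ a b c d : ℝ,
            T = a • (1 : BoundedOp H) + b • I + c • J + d • (I * J)) := by
  have : Nontrivial (BoundedOp H) := by
    obtain ⟨v, hv⟩ := exists_ne (0 : H)
    exact ⟨1, 0, fun h => hv (congrArg (fun T : BoundedOp H => T v) h)⟩
  rcases (commutantStar_hasScalarSelfAdjoints hirr).trichotomy with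
    h | ⟨J, hJ, hJ2, h⟩ | ⟨I, J, ⟨hI, hI2⟩, ⟨hJ, hJ2⟩, hIJ, h⟩
  · refine .inl ⟨nonempty_algEquiv_real h, fun T hT => ?_⟩
    obtain ⟨a, ha⟩ := h ⟨T, hT⟩
    exact ⟨a, congrArg Subtype.val ha⟩
  · refine .inr (.inl ⟨nonempty_algEquiv_complex hJ2 h, J, J.2,
      isUnitaryAntiSelfAdjoint_iff.2 ⟨congrArg Subtype.val hJ, congrArg Subtype.val hJ2⟩,
      fun T hT => ?_⟩)
    obtain ⟨a, b, ha⟩ := h ⟨T, hT⟩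
    exact ⟨a, b, congrArg Subtype.val ha⟩
  · refine .inr (.inr ⟨nonempty_algEquiv_quaternion hI2 hJ2 hIJ h, I, I.2, J, J.2,
      isUnitaryAntiSelfAdjoint_iff.2 ⟨congrArg Subtype.val hI, congrArg Subtype.val hI2⟩,
      isUnitaryAntiSelfAdjoint_iff.2 ⟨congrArg Subtype.val hJ, congrArg Subtype.val hJ2⟩,
      congrArg Subtype.val hIJ, fun T hT => ?_⟩)
    obtain ⟨a, b, c, d, ha⟩ := h ⟨T, hT⟩
    exact ⟨a, b, c, d, congrArg Subtype.val ha⟩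

/-! ### Identification of an operator algebra with the bounded operators on a component -/

/-- Rewrites the order as a ring identity, which a ring isomorphism preserves and reflects. -/
theorem Projections.le_iff {k M : Type*} [Semiring k] [AddCommGroup M] [TopologicalSpace M]
    [IsTopologicalAddGroup M] [Module k M] [StarRing (M →L[k] M)] {R : Set (M →L[k] M)}
    (E F : Projections R) : E ≤ F ↔ F.op * E.op = E.op := by
  constructor
  · intro h
    ext v
    obtain ⟨w, hw⟩ := h ⟨v, rfl⟩
    change F.op (E.op v) = E.op v
    rw [← hw]
    exact congrArg (fun T : M →L[k] M => T w) F.isStarProjection.isIdempotentElem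
  · rintro h _ ⟨v, rfl⟩
    exact ⟨E.op v, congrArg (fun T : M →L[k] M => T v) h⟩

/-- Reduces the identification to existence and uniqueness of extensions and to the membership
criterion. The map `f` reads the scalar product of `V` off that of `H`, so adjoints restrict
correctly; projections, their order and orthocomplements are then algebraic. -/
theorem IsQuaternionicExtension.of_restriction {k V : Type*} [RCLike k] [NormedAddCommGroup V]
    [InnerProductSpace k V] [CompleteSpace V] {R : StarSubalgebra ℝ (BoundedOp H)} {ι : V → H}
    (hinj : Function.Injective ι) (hadd : ∀ u v, ι (u + v) = ι u + ι v)
    (hreal : ∀ (a : ℝ) v, ι ((a : k) • v) = a • ι v) (f : ℍ[ℝ] → k)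
    (hinner : ∀ u v, inner k u v = f (qinner (ι u) (ι v)))
    (hext : ∀ S : V →L[k] V, ∃ T : BoundedOp H, ∀ v, T (ι v) = ι (S v))
    (huniq : ∀ T T' : BoundedOp H, (∀ v, T (ι v) = T' (ι v)) → T = T')
    (hmem : ∀ T : BoundedOp H, T ∈ R ↔ ∃ S : V →L[k] V, ∀ v, T (ι v) = ι (S v)) :
    IsQuaternionicExtension (k := k) R ι := by
  choose ext hext using hext
  choose res hres using fun T : R => (hmem T).1 T.2
  have hext_mem : ∀ S, ext S ∈ R := fun S => (hmem _).2 ⟨S, hext S⟩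
  have hres_eq : ∀ (T : R) (S : V →L[k] V), (∀ v, (T : BoundedOp H) (ι v) = ι (S v)) →
      res T = S := fun T S h => by
    ext v
    exact hinj ((hres T v).symm.trans (h v))
  let Φ : R ≃+* (V →L[k] V) :=
    { toFun := res
      invFun := fun S => ⟨ext S, hext_mem S⟩
      left_inv := fun T => Subtype.ext (huniq _ _ fun v => (hext _ v).trans (hres T v).symm)
      right_inv := fun S => hres_eq _ _ (hext S)
      map_mul' := fun S T => hres_eq _ _ fun v => by
        change (S : BoundedOp H) ((T : BoundedOp H) (ι v)) = _
        rw [hres, hres]; rfl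
      map_add' := fun S T => hres_eq _ _ fun v => by
        change (S : BoundedOp H) (ι v) + (T : BoundedOp H) (ι v) = _
        rw [hres, hres, ← hadd]; rfl }
  have hΦ : ∀ (T : R) (v : V), (T : BoundedOp H) (ι v) = ι (Φ T v) := hres
  have hΦs : ∀ T : R, Φ (star T) = star (Φ T) := fun T => by
    rw [ContinuousLinearMap.star_eq_adjoint, ContinuousLinearMap.eq_adjoint_iff]
    intro u v
    rw [hinner, hinner, ← hΦ, ← hΦ]
    exact congrArg f (qinner_star_apply _ _ _)
  have hproj : ∀ T : R, IsStarProjection (T : BoundedOp H) ↔ IsStarProjection (Φ T) := fun T => by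
    rw [isStarProjection_iff, isStarProjection_iff, IsIdempotentElem, IsIdempotentElem,
      IsSelfAdjoint, IsSelfAdjoint, ← hΦs, ← map_mul, Φ.injective.eq_iff, Φ.injective.eq_iff,
      Subtype.ext_iff, Subtype.ext_iff]
    rfl
  let Ψ : Projections (R : Set (BoundedOp H)) ≃o Projections (Set.univ : Set (V →L[k] V)) :=
    { toFun := fun E => ⟨Φ ⟨E.op, E.mem⟩, trivial, (hproj ⟨E.op, E.mem⟩).1 E.isStarProjection⟩
      invFun := fun P => ⟨Φ.symm P.op, (Φ.symm P.op).2, (hproj _).2 (by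
        rw [Φ.apply_symm_apply]; exact P.isStarProjection)⟩
      left_inv := fun E => Projections.ext (by
        change ((Φ.symm (Φ ⟨E.op, E.mem⟩) : R) : BoundedOp H) = E.op
        rw [Φ.symm_apply_apply])
      right_inv := fun P => Projections.ext (Φ.apply_symm_apply P.op)
      map_rel_iff' := fun {E F} => by
        rw [Projections.le_iff, Projections.le_iff]
        change Φ ⟨F.op, F.mem⟩ * Φ ⟨E.op, E.mem⟩ = Φ ⟨E.op, E.mem⟩ ↔ _
        rw [← map_mul, Φ.injective.eq_iff, Subtype.ext_iff]
        rfl }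
  refine ⟨fun S => ⟨ext S, hext S, fun T hT => huniq _ _ fun v => (hT v).trans (hext S v).symm⟩,
    hmem, ⟨Φ, fun a T => ?_, hΦs, hΦ⟩, ⟨Ψ, fun E v => hΦ ⟨E.op, E.mem⟩ v, fun E F h => ?_⟩⟩
  · refine hres_eq _ _ fun v => ?_
    change a • (T : BoundedOp H) (ι v) = ι ((a : k) • Φ T v)
    rw [hreal, hΦ]
  · have : (⟨F.op, F.mem⟩ : R) = 1 - ⟨E.op, E.mem⟩ := Subtype.ext h
    change Φ ⟨F.op, F.mem⟩ = 1 - Φ ⟨E.op, E.mem⟩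
    rw [this, map_sub, map_one]

/-- Real linearity and compatibility with two anticommuting units give right linearity. -/
theorem map_smul_right_of_anticomm {i j : ImagUnit} (hij : (i : ℍ[ℝ]) * j = -((j : ℍ[ℝ]) * i))
    (T : H →L[ℝ] H) (hi : ∀ v, T (v <• (i : ℍ[ℝ])) = T v <• (i : ℍ[ℝ]))
    (hj : ∀ v, T (v <• (j : ℍ[ℝ])) = T v <• (j : ℍ[ℝ])) (q : ℍ[ℝ]) (v : H) :
    T (v <• q) = T v <• q := by
  obtain ⟨a, b, c, d, rfl⟩ := ImagUnit.exists_eq_quaternion hij q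
  simp only [MulOpposite.op_add, MulOpposite.op_smul, MulOpposite.op_mul, MulOpposite.op_one,
    add_smul, smul_assoc, mul_smul, one_smul, map_add, map_smul, hi, hj]

/-- An additive continuous map compatible with two anticommuting units is a bounded right linear
operator. -/
theorem exists_boundedOp_of_anticomm {i j : ImagUnit}
    (hij : (i : ℍ[ℝ]) * j = -((j : ℍ[ℝ]) * i)) (T : H → H) (hT : Continuous T)
    (hadd : ∀ u v, T (u + v) = T u + T v)
    (hi : ∀ v, T (v <• (i : ℍ[ℝ])) = T v <• (i : ℍ[ℝ]))
    (hj : ∀ v, T (v <• (j : ℍ[ℝ])) = T v <• (j : ℍ[ℝ])) :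
    ∃ T' : BoundedOp H, ∀ v, T' v = T v :=
  -- Continuity upgrades additivity to real linearity.
  ⟨ofCommute ((AddMonoidHom.mk' T hadd).toRealLinearMap hT)
    (map_smul_right_of_anticomm hij _ hi hj), fun _ => rfl⟩

theorem map_real_smul (T : BoundedOp H) (r : ℝ) (v : H) : T (r • v) = r • T v :=
  (T.restrictScalars ℝ).map_smul r v

theorem map_rightMul (T : BoundedOp H) (q : ℍ[ℝ]) (v : H) : T (rightMul q v) = rightMul q (T v) :=
  T.map_smul (MulOpposite.op q) v

theorem rightMul_imagUnit_self (i : ImagUnit) (v : H) :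
    rightMul (i : ℍ[ℝ]) (rightMul (i : ℍ[ℝ]) v) = -v := by
  rw [rightMul_apply, rightMul_apply, smul_smul, ← MulOpposite.op_mul, i.2]; simp

theorem rightMul_anticomm {i j : ImagUnit} (hij : (i : ℍ[ℝ]) * j = -((j : ℍ[ℝ]) * i)) (v : H) :
    rightMul (i : ℍ[ℝ]) (rightMul (j : ℍ[ℝ]) v) = -rightMul (j : ℍ[ℝ]) (rightMul (i : ℍ[ℝ]) v) := by
  simp only [rightMul_apply]
  rw [smul_smul, smul_smul, ← MulOpposite.op_mul, ← MulOpposite.op_mul, hij]; simp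

theorem embC_I (i : ImagUnit) : embC i Complex.I = i := by simp [embC]

/-- A quaternion that commutes with `i` lies in the plane of `i`. -/
theorem embC_projC_of_commute {i : ImagUnit} {q : ℍ[ℝ]} (h : q * i = i * q) :
    embC i (projC i q) = q := by
  have hr := i.re_eq_zero
  have hn := i.norm_eq
  have h1 := congrArg QuaternionAlgebra.imI h
  have h2 := congrArg QuaternionAlgebra.imJ h
  have h3 := congrArg QuaternionAlgebra.imK h
  simp [hr] at h1 h2 h3
  apply Quaternion.ext <;> simp [embC, projC, hr]
  -- Components of `i × (q × i) = (i · i) q - (i · q) i` for the imaginary parts. Commuting with `i`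
  -- means that `2 (q × i)` vanishes, whence the halves.
  · linear_combination q.imI * hn - (i : ℍ[ℝ]).imJ * h3 / 2 + (i : ℍ[ℝ]).imK * h2 / 2
  · linear_combination q.imJ * hn - (i : ℍ[ℝ]).imK * h1 / 2 + (i : ℍ[ℝ]).imI * h3 / 2
  · linear_combination q.imK * hn - (i : ℍ[ℝ]).imI * h2 / 2 + (i : ℍ[ℝ]).imJ * h1 / 2

/-- The scalar products of vectors on which a unitary `J` acts as `i` commute with `i`. -/
theorem qinner_commute {J : BoundedOp H} (hJ : IsUnitaryAntiSelfAdjoint J) {i : ImagUnit} {u v : H}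
    (hu : J u = u <• (i : ℍ[ℝ])) (hv : J v = v <• (i : ℍ[ℝ])) :
    qinner u v * i = i * qinner u v := by
  have h1 : qinner (J u) (J v) = qinner u v := by
    rw [← qinner_star_apply]
    congr 1
    exact congrArg (fun T : BoundedOp H => T u) hJ.1.1
  -- Unitarity of `J` now reads `-i q i = q` with `q = qinner u v`.
  rw [hu, hv, qinner_smul_left, qinner_smul_right, i.star_eq] at h1
  calc qinner u v * i = -((i * i : ℍ[ℝ]) * (qinner u v * i)) := by rw [i.2]; simp
    _ = i * (-i * (qinner u v * i)) := by noncomm_ring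
    _ = i * qinner u v := by rw [h1]

/-- Commuting with `i` puts `q = x + y i` in the plane of `i`; commuting with `j`, which
anticommutes with `i`, then forces `y = 0`. -/
theorem eq_coe_re_of_commute {i j : ImagUnit} (hij : (i : ℍ[ℝ]) * j = -((j : ℍ[ℝ]) * i)) {q : ℍ[ℝ]}
    (hi : q * i = i * q) (hj : q * j = j * q) : q = (q.re : ℍ[ℝ]) := by
  have h := embC_projC_of_commute hi
  have hre : (projC i q).re = q.re := rfl
  set y := (projC i q).im with hy
  rw [embC, hre, ← hy] at h
  have h1 : (y : ℍ[ℝ]) * (i * j) = 0 := by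
    rw [← h, add_mul, mul_add, Quaternion.coe_commutes q.re, add_right_inj, mul_assoc,
      ← mul_assoc (j : ℍ[ℝ]), ← Quaternion.coe_commutes y (j : ℍ[ℝ]), mul_assoc (y : ℍ[ℝ]) j,
      ← neg_neg ((j : ℍ[ℝ]) * i), ← hij] at hj
    have h2 : (2 : ℝ) • ((y : ℍ[ℝ]) * (i * j)) = 0 := by
      rw [two_smul]
      nth_rewrite 1 [hj]
      rw [mul_neg, neg_add_cancel]
    exact (smul_eq_zero_iff_right two_ne_zero).1 h2
  have hne : ∀ i : ImagUnit, (i : ℍ[ℝ]) ≠ 0 := fun i h0 => by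
    have := i.2
    rw [h0] at this
    simp at this
  have h3 : (y : ℍ[ℝ]) = 0 :=
    (mul_eq_zero.1 h1).resolve_right (mul_ne_zero (hne i) (hne j))
  rw [h3, zero_mul, add_zero] at h
  exact h.symm

/-! ### The complex component -/

section Complex

variable {J : BoundedOp H} {i j : ImagUnit}

theorem mem_complexComponent {v : H} :
    v ∈ complexComponent J i ↔ J v = rightMul (i : ℍ[ℝ]) v := Iff.rfl

/-- The projection onto `H⁺_{J,i}` along `H⁻_{J,i}`. -/
noncomputable def complexProj (hJ : ∀ v, J (J v) = -v) (i : ImagUnit) (v : H) :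
    complexComponent J i :=
  ⟨(1 / 2 : ℝ) • (v - rightMul (i : ℍ[ℝ]) (J v)), by
    rw [mem_complexComponent, map_real_smul, map_sub, map_rightMul, hJ, map_smul, map_sub,
      rightMul_imagUnit_self, map_neg]
    module⟩

variable (hJ : ∀ v, J (J v) = -v)

theorem coe_complexProj (v : H) : (complexProj hJ i v : H) =
    (1 / 2 : ℝ) • (v - rightMul (i : ℍ[ℝ]) (J v)) := rfl

theorem continuous_complexProj : Continuous (complexProj hJ i) :=
  Continuous.subtype_mk (((continuous_id).sub
    ((rightMul (i : ℍ[ℝ])).continuous.comp J.continuous)).const_smul _) _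

theorem complexProj_add (u v : H) :
    complexProj hJ i (u + v) = complexProj hJ i u + complexProj hJ i v := Subtype.ext (by
  simp only [AddSubgroup.coe_add, coe_complexProj, map_add]
  module)

theorem complexProj_neg (v : H) : complexProj hJ i (-v) = -complexProj hJ i v := Subtype.ext (by
  simp only [AddSubgroup.coe_neg, coe_complexProj, map_neg]
  module)

theorem complexProj_coe (v : complexComponent J i) : complexProj hJ i v = v := Subtype.ext (by
  rw [coe_complexProj, mem_complexComponent.1 v.2, rightMul_imagUnit_self]
  module)

theorem complexProj_rightMul (v : H) :
    complexProj hJ i (rightMul (i : ℍ[ℝ]) v) = Complex.I • complexProj hJ i v := Subtype.ext (by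
  rw [coe_complex_smul, embC_I, ← rightMul_apply]
  simp only [coe_complexProj, map_rightMul, map_smul, map_sub])

/-- Right multiplication by `j` exchanges `H⁺` and `H⁻`, and `j⁻¹ = -j`, so the second term is the
component of `v` in `H⁻ = H⁺ j`. -/
theorem complexProj_decomposition (hij : (i : ℍ[ℝ]) * j = -((j : ℍ[ℝ]) * i)) (v : H) :
    v = complexProj hJ i v -
      rightMul (j : ℍ[ℝ]) (complexProj hJ i (rightMul (j : ℍ[ℝ]) v) : H) := by
  simp only [coe_complexProj, map_rightMul, map_smul, map_sub, rightMul_anticomm hij,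
    rightMul_imagUnit_self, map_neg]
  module

include hJ

theorem eq_of_eqOn_complexComponent (i : ImagUnit) {T T' : BoundedOp H}
    (h : ∀ v : complexComponent J i, T v = T' v) : T = T' := by
  obtain ⟨j, hij⟩ := i.exists_anticomm
  ext v
  rw [complexProj_decomposition hJ hij v, map_sub, map_sub, map_rightMul, map_rightMul, h, h]

/-- The decomposition dictates the extension `v ↦ S (P v) - S (P (v j)) j`. Complex linearity of `S`
makes it commute with right multiplication by `i`; for `j` the two terms change places. -/
theorem exists_extension_complexComponent
    (S : complexComponent J i →L[ℂ] complexComponent J i) :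
    ∃ T : BoundedOp H, ∀ v : complexComponent J i, T v = S v := by
  obtain ⟨j, hij⟩ := i.exists_anticomm
  have hP := continuous_complexProj (i := i) hJ
  have hSI : ∀ v, ((S (Complex.I • v) : complexComponent J i) : H) =
      rightMul (i : ℍ[ℝ]) (S v : H) := fun v => by
    rw [S.map_smul, coe_complex_smul, embC_I, rightMul_apply]
  obtain ⟨T, hT⟩ := exists_boundedOp_of_anticomm hij
    (fun v => (S (complexProj hJ i v) : H) -
      rightMul (j : ℍ[ℝ]) (S (complexProj hJ i (rightMul (j : ℍ[ℝ]) v)) : H))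
    ((continuous_subtype_val.comp (S.continuous.comp hP)).sub
      ((rightMul (j : ℍ[ℝ])).continuous.comp (continuous_subtype_val.comp
        (S.continuous.comp (hP.comp (rightMul (j : ℍ[ℝ])).continuous)))))
    (fun u v => by
      simp only [map_add, complexProj_add, AddSubgroup.coe_add]
      abel)
    (fun v => by
      simp only [← rightMul_apply]
      have h1 : rightMul (j : ℍ[ℝ]) (rightMul (i : ℍ[ℝ]) v) =
          -rightMul (i : ℍ[ℝ]) (rightMul (j : ℍ[ℝ]) v) := by
        rw [rightMul_anticomm hij, neg_neg]
      simp only [h1, complexProj_neg, complexProj_rightMul, hSI, map_neg, map_sub,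
        AddSubgroup.coe_neg]
      simp only [rightMul_anticomm hij])
    (fun v => by
      simp only [← rightMul_apply, rightMul_imagUnit_self, complexProj_neg, map_neg, map_sub,
        AddSubgroup.coe_neg]
      abel)
  refine ⟨T, fun v => eq_of_sub_eq_zero ?_⟩
  -- For `v` in `H⁺`, `v j` lies in `H⁻`, the kernel of the projection.
  have h0 : complexProj hJ i (rightMul (j : ℍ[ℝ]) (v : H)) = 0 := Subtype.ext (by
    rw [coe_complexProj, map_rightMul, mem_complexComponent.1 v.2, rightMul_anticomm hij,
      rightMul_imagUnit_self, map_neg, neg_neg, sub_self, smul_zero, AddSubgroup.coe_zero])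
  rw [hT, complexProj_coe, h0]
  simp

/-- An operator commuting with `J` preserves its component. Conversely, if `T` preserves the
component, then `J * T` and `T * J` agree there, hence everywhere by uniqueness of extensions. -/
theorem isQuaternionicExtension_complexComponent {R : StarSubalgebra ℝ (BoundedOp H)}
    (hR : ∀ T, T ∈ R ↔ J * T = T * J) (i : ImagUnit) :
    IsQuaternionicExtension (k := ℂ) (V := complexComponent J i) R Subtype.val := by
  refine .of_restriction Subtype.val_injective (fun _ _ => rfl) (fun a v => ?_) (projC i)
    (fun _ _ => rfl) (exists_extension_complexComponent hJ)
    (fun T T' => eq_of_eqOn_complexComponent hJ i) fun T => ⟨fun hT => ?_, ?_⟩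
  · rw [coe_complex_smul, real_smul_def]
    simp [embC]
  · have hcomm : ∀ v, J (T v) = T (J v) := fun v =>
      congrArg (fun T : BoundedOp H => T v) ((hR T).1 hT)
    refine ⟨{ toFun := fun v => ⟨T v, ?_⟩, map_add' := ?_, map_smul' := ?_, cont := ?_ },
      fun v => rfl⟩
    · rw [mem_complexComponent, hcomm, mem_complexComponent.1 v.2, map_rightMul]
    · exact fun u v => Subtype.ext (map_add T (u : H) v)
    · exact fun z v => Subtype.ext (T.map_smul _ (v : H))
    · exact (T.continuous.comp continuous_subtype_val).subtype_mk _
  · rintro ⟨S, hS⟩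
    refine (hR T).2 (eq_of_eqOn_complexComponent hJ i fun v => ?_)
    change J (T v) = T (J v)
    rw [mem_complexComponent.1 v.2, map_rightMul, hS, mem_complexComponent.1 (S v).2]

end Complex

/-! ### The real component -/

section Real

variable {I J : BoundedOp H} {i j : ImagUnit}

theorem mem_realComponent {v : H} : v ∈ realComponent I J i j ↔
    I v = rightMul (i : ℍ[ℝ]) v ∧ J v = rightMul (j : ℍ[ℝ]) v := Iff.rfl

variable (hI : ∀ v, I (I v) = -v) (hJ : ∀ v, J (J v) = -v) (hJI : ∀ v, J (I v) = -I (J v))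
  (hij : (i : ℍ[ℝ]) * j = -((j : ℍ[ℝ]) * i))

/-- The projection onto `H_ℝ`. -/
noncomputable def realProj (v : H) : realComponent I J i j :=
  ⟨(1 / 4 : ℝ) • (v - rightMul (i : ℍ[ℝ]) (I v) - rightMul (j : ℍ[ℝ]) (J v) -
      rightMul (j : ℍ[ℝ]) (rightMul (i : ℍ[ℝ]) (I (J v)))), by
    rw [mem_realComponent]
    simp only [map_real_smul, map_sub, map_rightMul, hI, hJ, hJI, map_smul, map_neg,
      rightMul_anticomm hij, rightMul_imagUnit_self]
    constructor <;> module⟩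

theorem coe_realProj (v : H) : (realProj hI hJ hJI hij v : H) =
    (1 / 4 : ℝ) • (v - rightMul (i : ℍ[ℝ]) (I v) - rightMul (j : ℍ[ℝ]) (J v) -
      rightMul (j : ℍ[ℝ]) (rightMul (i : ℍ[ℝ]) (I (J v)))) := rfl

theorem continuous_realProj : Continuous (realProj hI hJ hJI hij) := by
  have hi := (rightMul (i : ℍ[ℝ]) : H →L[ℝ] H).continuous
  have hj := (rightMul (j : ℍ[ℝ]) : H →L[ℝ] H).continuous
  exact Continuous.subtype_mk ((((continuous_id.sub (hi.comp I.continuous)).sub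
    (hj.comp J.continuous)).sub
    (hj.comp (hi.comp (I.continuous.comp J.continuous)))).const_smul _) _

theorem realProj_add (u v : H) : realProj hI hJ hJI hij (u + v) =
    realProj hI hJ hJI hij u + realProj hI hJ hJI hij v := Subtype.ext (by
  simp only [Submodule.coe_add, coe_realProj, map_add]
  module)

theorem realProj_neg (v : H) : realProj hI hJ hJI hij (-v) =
    -realProj hI hJ hJI hij v := Subtype.ext (by
  simp only [Submodule.coe_neg, coe_realProj, map_neg]
  module)

/-- This is `v = ∑ P (v e⁻¹) e` over `e = 1, i, j, ij`, with `e⁻¹ = -e` for the last three. In the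
sum the terms involving `I` or `J` cancel and four copies of `v / 4` remain. -/
theorem realProj_decomposition (v : H) :
    v = realProj hI hJ hJI hij v -
      rightMul (i : ℍ[ℝ]) (realProj hI hJ hJI hij (rightMul (i : ℍ[ℝ]) v) : H) -
      rightMul (j : ℍ[ℝ]) (realProj hI hJ hJI hij (rightMul (j : ℍ[ℝ]) v) : H) -
      rightMul (j : ℍ[ℝ]) (rightMul (i : ℍ[ℝ])
        (realProj hI hJ hJI hij (rightMul (j : ℍ[ℝ]) (rightMul (i : ℍ[ℝ]) v)) : H)) := by
  simp only [coe_realProj, map_rightMul, map_smul, map_sub, rightMul_anticomm hij,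
    rightMul_imagUnit_self, map_neg]
  module

theorem realProj_coe (v : realComponent I J i j) :
    realProj hI hJ hJI hij v = v := Subtype.ext (by
  obtain ⟨h1, h2⟩ := mem_realComponent.1 v.2
  simp only [coe_realProj, h1, h2, map_rightMul, rightMul_imagUnit_self, rightMul_anticomm hij,
    map_neg]
  module)

theorem realProj_rightMul_coe (v : realComponent I J i j) :
    realProj hI hJ hJI hij (rightMul (i : ℍ[ℝ]) (v : H)) = 0 ∧
      realProj hI hJ hJI hij (rightMul (j : ℍ[ℝ]) (v : H)) = 0 ∧
      realProj hI hJ hJI hij (rightMul (j : ℍ[ℝ]) (rightMul (i : ℍ[ℝ]) (v : H))) = 0 := by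
  obtain ⟨h1, h2⟩ := mem_realComponent.1 v.2
  refine ⟨Subtype.ext ?_, Subtype.ext ?_, Subtype.ext ?_⟩ <;>
  · simp only [coe_realProj, h1, h2, map_rightMul, rightMul_imagUnit_self, rightMul_anticomm hij,
      map_neg, Submodule.coe_zero]
    module

include hI hJ hJI hij

theorem eq_of_eqOn_realComponent {T T' : BoundedOp H}
    (h : ∀ v : realComponent I J i j, T v = T' v) : T = T' := by
  ext v
  rw [realProj_decomposition hI hJ hJI hij v]
  simp only [map_sub, map_rightMul, h]

/-- `S` is applied to each of the four components of `v`. Right multiplication by `i` or `j`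
permutes the four terms up to sign, so the result is right linear. -/
theorem exists_extension_realComponent
    (S : realComponent I J i j →L[ℝ] realComponent I J i j) :
    ∃ T : BoundedOp H, ∀ v : realComponent I J i j, T v = S v := by
  have hP := continuous_realProj hI hJ hJI hij
  have hi := (rightMul (i : ℍ[ℝ]) : H →L[ℝ] H).continuous
  have hj := (rightMul (j : ℍ[ℝ]) : H →L[ℝ] H).continuous
  have hS : Continuous fun v => (S (realProj hI hJ hJI hij v) : H) :=
    continuous_subtype_val.comp (S.continuous.comp hP)
  obtain ⟨T, hT⟩ := exists_boundedOp_of_anticomm hij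
    (fun v => (S (realProj hI hJ hJI hij v) : H) -
      rightMul (i : ℍ[ℝ]) (S (realProj hI hJ hJI hij (rightMul (i : ℍ[ℝ]) v)) : H) -
      rightMul (j : ℍ[ℝ]) (S (realProj hI hJ hJI hij (rightMul (j : ℍ[ℝ]) v)) : H) -
      rightMul (j : ℍ[ℝ]) (rightMul (i : ℍ[ℝ])
        (S (realProj hI hJ hJI hij (rightMul (j : ℍ[ℝ]) (rightMul (i : ℍ[ℝ]) v))) : H)))
    (((hS.sub (hi.comp (hS.comp hi))).sub (hj.comp (hS.comp hj))).sub
      (hj.comp (hi.comp (hS.comp (hj.comp hi)))))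
    (fun u v => by
      simp only [map_add, realProj_add, Submodule.coe_add]
      abel)
    (fun v => by
      simp only [← rightMul_apply, rightMul_imagUnit_self, rightMul_anticomm hij, realProj_neg,
        map_neg, Submodule.coe_neg, map_sub]
      abel)
    (fun v => by
      simp only [← rightMul_apply, rightMul_imagUnit_self, rightMul_anticomm hij, realProj_neg,
        map_neg, Submodule.coe_neg, map_sub]
      abel)
  refine ⟨T, fun v => ?_⟩
  obtain ⟨h1, h2, h3⟩ := realProj_rightMul_coe hI hJ hJI hij v
  rw [hT, realProj_coe, h1, h2, h3]
  simp

theorem isQuaternionicExtension_realComponent {R : StarSubalgebra ℝ (BoundedOp H)}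
    (hR : ∀ T, T ∈ R ↔ I * T = T * I ∧ J * T = T * J) :
    IsQuaternionicExtension (k := ℝ) (V := realComponent I J i j) R Subtype.val := by
  refine .of_restriction Subtype.val_injective (fun _ _ => rfl) (fun _ _ => rfl)
    QuaternionAlgebra.re (fun _ _ => rfl) (exists_extension_realComponent hI hJ hJI hij)
    (fun T T' => eq_of_eqOn_realComponent hI hJ hJI hij) fun T => ⟨fun hT => ?_, ?_⟩
  · have hcI : ∀ v, I (T v) = T (I v) := fun v =>
      congrArg (fun T : BoundedOp H => T v) ((hR T).1 hT).1
    have hcJ : ∀ v, J (T v) = T (J v) := fun v =>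
      congrArg (fun T : BoundedOp H => T v) ((hR T).1 hT).2
    refine ⟨{ toFun := fun v => ⟨T v, ?_⟩, map_add' := ?_, map_smul' := ?_, cont := ?_ },
      fun v => rfl⟩
    · obtain ⟨h1, h2⟩ := mem_realComponent.1 v.2
      rw [mem_realComponent, hcI, hcJ, h1, h2, map_rightMul, map_rightMul]
      exact ⟨rfl, rfl⟩
    · exact fun u v => Subtype.ext (map_add T (u : H) v)
    · exact fun r v => Subtype.ext (map_real_smul T r (v : H))
    · exact (T.continuous.comp continuous_subtype_val).subtype_mk _
  · rintro ⟨S, hS⟩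
    refine (hR T).2 ⟨eq_of_eqOn_realComponent hI hJ hJI hij fun v => ?_,
      eq_of_eqOn_realComponent hI hJ hJI hij fun v => ?_⟩
    · change I (T v) = T (I v)
      rw [(mem_realComponent.1 v.2).1, map_rightMul, hS, (mem_realComponent.1 (S v).2).1]
    · change J (T v) = T (J v)
      rw [(mem_realComponent.1 v.2).2, map_rightMul, hS, (mem_realComponent.1 (S v).2).2]

end Real

/-! ### The structure theorem in each of the three cases -/

theorem quaternion_relations {A : Type*} [Ring A] {I J : A} (hI2 : I * I = -1)
    (hJ2 : J * J = -1) (hIJ : I * J = -(J * I)) :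
    J * I = -(I * J) ∧ J * (I * J) = I ∧ (I * J) * J = -I ∧ (I * J) * I = J ∧
      I * (I * J) = -J := by
  have hJI : J * I = -(I * J) := by rw [hIJ, neg_neg]
  refine ⟨hJI, ?_, ?_, ?_, ?_⟩
  · rw [← mul_assoc, hJI, neg_mul, mul_assoc, hJ2]; simp
  · rw [mul_assoc, hJ2]; simp
  · rw [mul_assoc, hJI, mul_neg, ← mul_assoc, hI2]; simp
  · rw [← mul_assoc, hI2]; simp

/-- Averaging `x` with its conjugate `-(I * x * I) = x` removes the `J` and `I * J` terms;
conjugating by `J` then removes the `I` term. Independence of the four elements is not needed. -/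
theorem eq_smul_one_of_commute {A : Type*} [Ring A] [Algebra ℝ A] {I J : A} (hI2 : I * I = -1)
    (hJ2 : J * J = -1) (hIJ : I * J = -(J * I)) {x : A} {a b c d : ℝ}
    (hx : x = a • (1 : A) + b • I + c • J + d • (I * J)) (hxI : I * x = x * I)
    (hxJ : J * x = x * J) : x = a • (1 : A) := by
  obtain ⟨hJI, hJK, hKJ, hKI, hIK⟩ := quaternion_relations hI2 hJ2 hIJ
  have hconj : ∀ {S : A}, S * S = -1 → S * x = x * S → x = -(S * x * S) := fun hS h => by
    rw [h, mul_assoc, hS]; simp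
  have h1 := hconj hI2 hxI
  have h2 := hconj hJ2 hxJ
  have e1 : I * x * I = -(a • (1 : A)) - b • I + c • J + d • (I * J) := by
    rw [hx]
    simp only [add_mul, mul_add, smul_mul_assoc, mul_smul_comm, mul_one, hI2, hKI, hIK,
      neg_mul, one_mul, hJI]
    module
  have e2 : x = a • (1 : A) + b • I := by
    have h3 : (2 : ℝ) • x = (2 : ℝ) • (a • (1 : A) + b • I) := by
      rw [two_smul]
      nth_rewrite 1 [h1]
      rw [e1, hx]
      module
    exact smul_right_injective A two_ne_zero h3
  have e3 : J * x * J = -(a • (1 : A)) + b • I := by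
    rw [e2]
    simp only [add_mul, mul_add, smul_mul_assoc, mul_smul_comm, mul_one, hJ2, hJI, neg_mul, hKJ]
    module
  have h4 : (2 : ℝ) • x = (2 : ℝ) • (a • (1 : A)) := by
    rw [two_smul]
    nth_rewrite 1 [h2]
    rw [e3, e2]
    module
  exact smul_right_injective A two_ne_zero h4

theorem mem_iff_commute_commutant {R : StarSubalgebra ℝ (BoundedOp H)}
    (hR : IsVonNeumannAlgebra R) {T : BoundedOp H} :
    T ∈ R ↔ ∀ A ∈ commutant R, A * T = T * A := by
  have h : T ∈ (R : Set (BoundedOp H)) ↔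
      T ∈ Set.centralizer (Set.centralizer (R : Set (BoundedOp H))) := by rw [hR]
  exact h

theorem IsUnitaryAntiSelfAdjoint.apply_apply {J : BoundedOp H} (hJ : IsUnitaryAntiSelfAdjoint J)
    (v : H) : J (J v) = -v :=
  congrArg (fun T : BoundedOp H => T v) (isUnitaryAntiSelfAdjoint_iff.1 hJ).2

theorem smul_one_mem_commutant (R : StarSubalgebra ℝ (BoundedOp H)) (a : ℝ) :
    a • (1 : BoundedOp H) ∈ commutant R :=
  (commutant R).smul_mem (one_mem _) a

theorem smul_one_mem (R : StarSubalgebra ℝ (BoundedOp H)) (a : ℝ) :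
    a • (1 : BoundedOp H) ∈ R :=
  R.toSubalgebra.smul_mem (one_mem R) a

theorem proper_quaternionic_case {R : StarSubalgebra ℝ (BoundedOp H)}
    (hR : IsVonNeumannAlgebra R) (h : ∀ T ∈ commutant R, ∃ a : ℝ, T = a • (1 : BoundedOp H)) :
    (commutant R : Set (BoundedOp H)) = {T | ∃ a : ℝ, T = a • (1 : BoundedOp H)} ∧
      R = ⊤ ∧
      center R = {T | ∃ a : ℝ, T = a • (1 : BoundedOp H)} ∧
      {E : BoundedOp H | E ∈ R ∧ IsStarProjection E} = {E | IsStarProjection E} := by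
  have hc : (commutant R : Set (BoundedOp H)) = {T | ∃ a : ℝ, T = a • (1 : BoundedOp H)} := by
    refine Set.Subset.antisymm h ?_
    rintro _ ⟨a, rfl⟩
    exact smul_one_mem_commutant R a
  have htop : R = ⊤ := by
    refine eq_top_iff.2 fun T _ => (mem_iff_commute_commutant hR).2 fun A hA => ?_
    obtain ⟨a, rfl⟩ := h A hA
    rw [smul_one_mul, mul_smul_one]
  refine ⟨hc, htop, ?_, ?_⟩
  · rw [center, hc]
    refine Set.inter_eq_right.2 ?_
    rintro _ ⟨a, rfl⟩
    exact smul_one_mem R a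
  · ext E
    refine ⟨And.right, fun hE => ⟨?_, hE⟩⟩
    rw [htop]
    trivial

theorem complex_induced_case [Nontrivial H] {R : StarSubalgebra ℝ (BoundedOp H)}
    (hR : IsVonNeumannAlgebra R) {J : BoundedOp H} (hJR : J ∈ commutant R)
    (hJ : IsUnitaryAntiSelfAdjoint J)
    (h : ∀ T ∈ commutant R, ∃ a b : ℝ, T = a • (1 : BoundedOp H) + b • J) :
    (commutant R : Set (BoundedOp H)) = {T | ∃ a b : ℝ, T = a • (1 : BoundedOp H) + b • J} ∧
      (∀ J' : BoundedOp H, IsUnitaryAntiSelfAdjoint J' →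
        (commutant R : Set (BoundedOp H)) = {T | ∃ a b : ℝ, T = a • (1 : BoundedOp H) + b • J'} →
        J' = J ∨ J' = -J) ∧
      center R = {T | ∃ a b : ℝ, T = a • (1 : BoundedOp H) + b • J} ∧
      ∀ i : ImagUnit,
        (CompleteSpace (complexComponent J i) ∧ ∀ u v : complexComponent J i,
          qinner (u : H) (v : H) = embC i (inner ℂ u v)) ∧
        IsQuaternionicExtension (k := ℂ) (V := complexComponent J i) R Subtype.val := by
  -- By the bicommutant property it suffices to commute with the single generator `J` of the
  -- commutant.
  have hmem : ∀ T, T ∈ R ↔ J * T = T * J := fun T => by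
    rw [mem_iff_commute_commutant hR]
    refine ⟨fun hT => hT J hJR, fun hT A hA => ?_⟩
    obtain ⟨a, b, rfl⟩ := h A hA
    rw [add_mul, mul_add, smul_mul_assoc, smul_mul_assoc, mul_smul_comm, mul_smul_comm, hT, one_mul,
      mul_one]
  have hc : (commutant R : Set (BoundedOp H)) =
      {T | ∃ a b : ℝ, T = a • (1 : BoundedOp H) + b • J} := by
    refine Set.Subset.antisymm h ?_
    rintro _ ⟨a, b, rfl⟩
    exact add_mem (smul_one_mem_commutant R a) ((commutant R).smul_mem hJR b)
  refine ⟨hc, fun J' hJ' hc' => ?_, ?_, fun i => ⟨⟨inferInstance, fun u v => ?_⟩, ?_⟩⟩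
  · obtain ⟨a, b, rfl⟩ : ∃ a b : ℝ, J' = a • (1 : BoundedOp H) + b • J :=
      h J' (hc' ▸ ⟨0, 1, by module⟩ : J' ∈ (commutant R : Set (BoundedOp H)))
    rw [isUnitaryAntiSelfAdjoint_iff] at hJ' hJ
    obtain ⟨hs, hsq⟩ := hJ'
    obtain ⟨v, hv⟩ := exists_ne (0 : H)
    have hcoef : ∀ r : ℝ, r • (1 : BoundedOp H) = 0 → r = 0 := fun r hr => by
      have : r • v = 0 := congrArg (fun T : BoundedOp H => T v) hr
      exact (smul_eq_zero.1 this).resolve_right hv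
    rw [star_add, star_smul, star_smul, star_one, hJ.1, star_trivial, star_trivial] at hs
    -- Skewness of `a + b J` kills the scalar part; its square being `-1` then gives `b * b = 1`.
    have ha : a = 0 := by
      have : (2 * a) • (1 : BoundedOp H) = 0 := by
        have h2 : (2 * a) • (1 : BoundedOp H) =
            (a • (1 : BoundedOp H) + b • -J) - -(a • (1 : BoundedOp H) + b • J) := by module
        rw [h2, hs, sub_self]
      linarith [hcoef _ this]
    rw [ha, zero_smul, zero_add] at hsq ⊢
    have hb : b * b = 1 := by
      rw [smul_mul_smul_comm, hJ.2] at hsq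
      have : (1 - b * b) • (1 : BoundedOp H) = 0 := by
        have h2 : (1 - b * b) • (1 : BoundedOp H) = (b * b) • (-1 : BoundedOp H) - -1 := by module
        rw [h2, hsq, sub_self]
      linarith [hcoef _ this]
    rcases mul_self_eq_one_iff.1 hb with rfl | rfl
    · exact .inl (one_smul _ _)
    · exact .inr (by module)
  · rw [center, hc]
    refine Set.inter_eq_right.2 ?_
    rintro _ ⟨a, b, rfl⟩
    exact add_mem (smul_one_mem R a) (R.toSubalgebra.smul_mem ((hmem J).2 rfl) b)
  · rw [complex_inner_def, embC_projC_of_commute (qinner_commute hJ u.2 v.2)]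
  · exact isQuaternionicExtension_complexComponent hJ.apply_apply hmem i

theorem real_induced_case [Nontrivial H] {R : StarSubalgebra ℝ (BoundedOp H)}
    (hR : IsVonNeumannAlgebra R) {I J : BoundedOp H} (hIR : I ∈ commutant R)
    (hJR : J ∈ commutant R) (hI : IsUnitaryAntiSelfAdjoint I) (hJ : IsUnitaryAntiSelfAdjoint J)
    (hIJ : I * J = -(J * I))
    (h : ∀ T ∈ commutant R, ∃ a b c d : ℝ,
      T = a • (1 : BoundedOp H) + b • I + c • J + d • (I * J)) :
    ∃ I J K : BoundedOp H,
      (IsUnitaryAntiSelfAdjoint I ∧ IsUnitaryAntiSelfAdjoint J ∧ IsUnitaryAntiSelfAdjoint K) ∧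
      (I * J = -(J * I) ∧ J * K = -(K * J) ∧ K * I = -(I * K)) ∧
      (I ∉ R ∧ J ∉ R ∧ K ∉ R) ∧ I * J = K ∧
      (commutant R : Set (BoundedOp H)) =
        {T | ∃ a b c d : ℝ, T = a • (1 : BoundedOp H) + b • I + c • J + d • K} ∧
      center R = {T | ∃ a : ℝ, T = a • (1 : BoundedOp H)} ∧
      ∀ i j : ImagUnit, inner ℝ (i : ℍ[ℝ]) (j : ℍ[ℝ]) = 0 →
        (CompleteSpace (realComponent I J i j) ∧ ∀ u v : realComponent I J i j,
          qinner (u : H) (v : H) = ((inner ℝ u v : ℝ) : ℍ[ℝ])) ∧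
        IsQuaternionicExtension (k := ℝ) (V := realComponent I J i j) R Subtype.val := by
  obtain ⟨hIs, hI2⟩ := isUnitaryAntiSelfAdjoint_iff.1 hI
  obtain ⟨hJs, hJ2⟩ := isUnitaryAntiSelfAdjoint_iff.1 hJ
  obtain ⟨hJI, hJK, hKJ, hKI, hIK⟩ := quaternion_relations hI2 hJ2 hIJ
  have hKs : star (I * J) = -(I * J) := by rw [star_mul, hIs, hJs, hJI.symm]; exact neg_mul_neg J I
  have hK : IsUnitaryAntiSelfAdjoint (I * J) :=
    isUnitaryAntiSelfAdjoint_iff.2 ⟨hKs, by rw [← mul_assoc, hKI, hJ2]⟩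
  have hmem : ∀ T, T ∈ R ↔ I * T = T * I ∧ J * T = T * J := fun T => by
    rw [mem_iff_commute_commutant hR]
    refine ⟨fun hT => ⟨hT I hIR, hT J hJR⟩, fun ⟨hTI, hTJ⟩ A hA => ?_⟩
    have hTK : (I * J) * T = T * (I * J) := by
      rw [mul_assoc, hTJ, ← mul_assoc, hTI, mul_assoc]
    obtain ⟨a, b, c, d, rfl⟩ := h A hA
    simp only [add_mul, mul_add, smul_mul_assoc, mul_smul_comm, hTI, hTJ, hTK, one_mul, mul_one]
  have hc : (commutant R : Set (BoundedOp H)) =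
      {T | ∃ a b c d : ℝ, T = a • (1 : BoundedOp H) + b • I + c • J + d • (I * J)} := by
    refine Set.Subset.antisymm h ?_
    rintro _ ⟨a, b, c, d, rfl⟩
    exact add_mem (add_mem (add_mem (smul_one_mem_commutant R a) ((commutant R).smul_mem hIR b))
      ((commutant R).smul_mem hJR c)) ((commutant R).smul_mem (mul_mem hIR hJR) d)
  obtain ⟨v, hv⟩ := exists_ne (0 : H)
  -- If anticommuting `S, T` also commuted, `S * T` would vanish although both are invertible.
  -- Elements of `R` commute with `I` and `J`, so this excludes `I, J, I * J` from `R`.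
  have hne : ∀ S T : BoundedOp H, IsUnitaryAntiSelfAdjoint S → IsUnitaryAntiSelfAdjoint T →
      S * T = -(T * S) → S * T ≠ T * S := fun S T hS hT hST h0 => by
    have h1 : S (T v) = -T (S v) := congrArg (fun T : BoundedOp H => T v) hST
    have h2 : S (T v) = T (S v) := congrArg (fun T : BoundedOp H => T v) h0
    have h3 : S (T v) = 0 := by
      refine (smul_eq_zero_iff_right (two_ne_zero (α := ℝ))).1 ?_
      rw [two_smul]
      nth_rewrite 1 [h1]
      rw [h2, neg_add_cancel]
    have h4 : T v = 0 := by
      rw [← neg_eq_zero, ← hS.apply_apply, h3, map_zero]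
    refine hv ?_
    rw [← neg_eq_zero, ← hT.apply_apply, h4, map_zero]
  refine ⟨I, J, I * J, ⟨hI, hJ, hK⟩, ⟨hIJ, by rw [hJK, hKJ, neg_neg], by rw [hKI, hIK, neg_neg]⟩,
    ⟨fun hR' => ?_, fun hR' => ?_, fun hR' => ?_⟩, rfl, hc, ?_, fun i j hij => ?_⟩
  · exact hne J I hJ hI hJI ((hmem I).1 hR').2
  · exact hne I J hI hJ hIJ ((hmem J).1 hR').1
  · exact hne I (I * J) hI hK (by rw [hIK, hKI]) ((hmem _).1 hR').1
  · refine Set.Subset.antisymm ?_ ?_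
    · rintro T ⟨hTR, hTc⟩
      obtain ⟨hTI, hTJ⟩ := (hmem T).1 hTR
      obtain ⟨a, b, c, d, hT⟩ := h T hTc
      exact ⟨a, eq_smul_one_of_commute hI2 hJ2 hIJ hT hTI hTJ⟩
    · rintro _ ⟨a, rfl⟩
      exact ⟨smul_one_mem R a, smul_one_mem_commutant R a⟩
  · have hij' := ImagUnit.anticomm_of_inner_eq_zero hij
    refine ⟨⟨inferInstance, fun u v => ?_⟩, ?_⟩
    · exact eq_coe_re_of_commute hij' (qinner_commute hI u.2.1 v.2.1)
        (qinner_commute hJ u.2.2 v.2.2)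
    · exact isQuaternionicExtension_realComponent hI.apply_apply hJ.apply_apply
        (fun v => congrArg (fun T : BoundedOp H => T v) hJI) hij' hmem

end QuatHilbert

/-! ### The classification -/

theorem mainTheorem1 {H : Type*} [NormedAddCommGroup H] [QuaternionicHilbertSpace H] [Nontrivial H]
    (R : StarSubalgebra ℝ (BoundedOp H)) (hR : IsVonNeumannAlgebra R)
    (hirr : IsIrreducibleFamily (R : Set (BoundedOp H))) :
    -- precisely one of the three cases occurs
    ((Nonempty (commutant R ≃ₐ[ℝ] ℝ) ∧ ¬ Nonempty (commutant R ≃ₐ[ℝ] ℂ) ∧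
          ¬ Nonempty (commutant R ≃ₐ[ℝ] ℍ[ℝ])) ∨
      (¬ Nonempty (commutant R ≃ₐ[ℝ] ℝ) ∧ Nonempty (commutant R ≃ₐ[ℝ] ℂ) ∧
          ¬ Nonempty (commutant R ≃ₐ[ℝ] ℍ[ℝ])) ∨
      (¬ Nonempty (commutant R ≃ₐ[ℝ] ℝ) ∧ ¬ Nonempty (commutant R ≃ₐ[ℝ] ℂ) ∧
          Nonempty (commutant R ≃ₐ[ℝ] ℍ[ℝ]))) ∧
    -- proper quaternionic case
    (Nonempty (commutant R ≃ₐ[ℝ] ℝ) →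
      (commutant R : Set (BoundedOp H)) = {T | ∃ a : ℝ, T = a • (1 : BoundedOp H)} ∧
      R = ⊤ ∧
      center R = {T | ∃ a : ℝ, T = a • (1 : BoundedOp H)} ∧
      {E : BoundedOp H | E ∈ R ∧ IsStarProjection E} = {E | IsStarProjection E}) ∧
    -- complex-induced case
    (Nonempty (commutant R ≃ₐ[ℝ] ℂ) →
      ∃ J : BoundedOp H, IsUnitaryAntiSelfAdjoint J ∧
        (commutant R : Set (BoundedOp H)) = {T | ∃ a b : ℝ, T = a • (1 : BoundedOp H) + b • J} ∧
        (∀ J' : BoundedOp H, IsUnitaryAntiSelfAdjoint J' →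
          (commutant R : Set (BoundedOp H)) = {T | ∃ a b : ℝ, T = a • (1 : BoundedOp H) + b • J'} →
          J' = J ∨ J' = -J) ∧
        center R = {T | ∃ a b : ℝ, T = a • (1 : BoundedOp H) + b • J} ∧
        ∀ i : ImagUnit,
          (CompleteSpace (complexComponent J i) ∧ ∀ u v : complexComponent J i,
            QuaternionicHilbertSpace.qinner (u : H) (v : H) = embC i (inner ℂ u v)) ∧
          IsQuaternionicExtension (k := ℂ) (V := complexComponent J i) R Subtype.val) ∧
    -- real-induced case
    (Nonempty (commutant R ≃ₐ[ℝ] ℍ[ℝ]) →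
      ∃ I J K : BoundedOp H,
        (IsUnitaryAntiSelfAdjoint I ∧ IsUnitaryAntiSelfAdjoint J ∧ IsUnitaryAntiSelfAdjoint K) ∧
        (I * J = -(J * I) ∧ J * K = -(K * J) ∧ K * I = -(I * K)) ∧
        (I ∉ R ∧ J ∉ R ∧ K ∉ R) ∧ I * J = K ∧
        (commutant R : Set (BoundedOp H)) =
          {T | ∃ a b c d : ℝ, T = a • (1 : BoundedOp H) + b • I + c • J + d • K} ∧
        center R = {T | ∃ a : ℝ, T = a • (1 : BoundedOp H)} ∧
        ∀ i j : ImagUnit, inner ℝ (i : ℍ[ℝ]) (j : ℍ[ℝ]) = 0 →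
          (CompleteSpace (realComponent I J i j) ∧ ∀ u v : realComponent I J i j,
            QuaternionicHilbertSpace.qinner (u : H) (v : H) = ((inner ℝ u v : ℝ) : ℍ[ℝ])) ∧
          IsQuaternionicExtension (k := ℝ) (V := realComponent I J i j) R Subtype.val) := by
  -- Each alternative carries both the abstract type and the concrete form of the commutant; the
  -- dimension lemmas discard the alternatives that do not match the assumed type.
  have tri := commutant_trichotomy hirr
  refine ⟨?_, fun hℝ => ?_, fun hℂ => ?_, fun hℍ => ?_⟩
  · rcases tri with ⟨h, -⟩ | ⟨h, -⟩ | ⟨h, -⟩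
    · exact .inl ⟨h, not_algEquiv_real_complex h, not_algEquiv_real_quaternion h⟩
    · exact .inr (.inl ⟨fun h' => not_algEquiv_real_complex h' h, h,
        not_algEquiv_complex_quaternion h⟩)
    · exact .inr (.inr ⟨fun h' => not_algEquiv_real_quaternion h' h,
        fun h' => not_algEquiv_complex_quaternion h' h, h⟩)
  · rcases tri with ⟨-, h⟩ | ⟨h, -⟩ | ⟨h, -⟩
    · exact proper_quaternionic_case hR h
    · exact absurd h (not_algEquiv_real_complex hℝ)
    · exact absurd h (not_algEquiv_real_quaternion hℝ)
  · rcases tri with ⟨h, -⟩ | ⟨-, J, hJR, hJ, h⟩ | ⟨h, -⟩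
    · exact absurd hℂ (not_algEquiv_real_complex h)
    · exact ⟨J, hJ, complex_induced_case hR hJR hJ h⟩
    · exact absurd h (not_algEquiv_complex_quaternion hℂ)
  · rcases tri with ⟨h, -⟩ | ⟨h, -⟩ | ⟨-, I, hIR, J, hJR, hI, hJ, hIJ, h⟩
    · exact absurd hℍ (not_algEquiv_real_quaternion h)
    · exact absurd hℍ (not_algEquiv_complex_quaternion h)
    · exact real_induced_case hR hIR hJR hI hJ hIJ h
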